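/- Let $r\ge 2$, $n\ge 1$ and $0\le k\le n$ be integers, let $\zeta=e^{2\pi i/r}$, and let $G_n=G(r,1,n)\subseteq GL_n(\mathbb C)$ be the group of monomial matrices whose nonzero entries are powers of $\zeta$. It acts on $\mathbb C[\mathbf x_n]=\mathbb C[x_1,\dots,x_n]$ by linear substitutions, $(g\cdot f)(v)=f(g^{-1}v)$. Write $e_d(\mathbf x_n^r)=e_d(x_1^r,\dots,x_n^r)$ for the elementary symmetric polynomials in $x_1^r,\dots,x_n^r$, and put $$I_{n,k}=\langle x_1^{kr+1},\dots,x_n^{kr+1},\,e_n(\mathbf x_n^r),e_{n-1}(\mathbf x_n^r),\dots,e_{n-k+1}(\mathbf x_n^r)\rangle,\qquad R_{n,k}=\mathbb C[\mathbf x_n]/I_{n,k},$$ $$J_{n,k}=\langle x_1^{kr},\dots,x_n^{kr},\,e_n(\mathbf x_n^r),e_{n-1}(\mathbf x_n^r),\dots,e_{n-k+1}(\mathbf x_n^r)\rangle,\qquad S_{n,k}=\mathbb C[\mathbf x_n]/J_{n,k}.$$ These ideals are $G_n$-stable, so that $R_{n,k}$ and $S_{n,k}$ are $G_n$-modules. Let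 $\mathcal F_{n,k}$ be the set of $k$-dimensional $G_n$-faces (identified with the $k$-dimensional faces of the Coxeter complex of $G_n$): ordered set partitions $(Z\mid B_1\mid\cdots\mid B_k)$ of $[n]=\{1,\dots,n\}$ in which $Z$ may be empty, the blocks $B_1,\dots,B_k$ are nonempty, every letter of $B_1,\dots,B_k$ carries a color in $\{0,1,\dots,r-1\}$, and the letters of the zero block $Z$ are uncolored. Let $\mathcal{OP}_{n,k}\subseteq\mathcal F_{n,k}$ be the subset of faces with $Z=\emptyset$, that is, the $r$-colored ordered set partitions of $[n]$ with $k$ blocks. An element $g\in G_n$ whose nonzero entry in column $i$ is $\zeta^{c}$, in row $i'$, sends the colored letter $i^{d}$ to $(i')^{d+c \bmod r}$ and the uncolored letter $i$ to $i'$; in this way $G_n$ acts on $\mathcal F_{n,k}$ and on $\mathcal{OP}_{n,k}$. Then, as ungraded $G_n$-modules, $$R_{n,k}\cong\mathbb C[\mathcal F_{n,k}]\qquad\text{and}\qquad S_{n,k}\cong\mathbb C[\mathcal{OP}_{n,k}].$$ Moreover, let $0<\alpha_1<\cdots<\alpha_k$ be any real numbers. Let $Y_{n,k}\subset\mathbb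 C^n$ be the set of points $(y_1,\dots,y_n)$ such that each $y_i$ is $0$ or of the form $\zeta^c\alpha_j$ with $0\le c\le r-1$ and $1\le j\le k$, and such that $\{\alpha_1,\dots,\alpha_k\}\subseteq\{|y_1|,\dots,|y_n|\}$; let $Z_{n,k}$ be the set of points of $Y_{n,k}$ all of whose coordinates are nonzero. For $Y\subseteq\mathbb C^n$ let $\mathbf T(Y)$ be the ideal generated by the top degree homogeneous components of the nonzero polynomials that vanish on $Y$. Then $$I_{n,k}=\mathbf T(Y_{n,k})\qquad\text{and}\qquad J_{n,k}=\mathbf T(Z_{n,k}).$$ -/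

import Mathlib

namespace ColoredCoinvariant

noncomputable section

open MvPolynomial

/-- The primitive `r`-th root of unity `ζ = exp (2πi / r)`. -/
def zeta (r : ℕ) : ℂ := Complex.exp (2 * Real.pi * Complex.I / r)

theorem zeta_ne_zero (r : ℕ) : zeta r ≠ 0 := Complex.exp_ne_zero _

theorem zeta_primitive (r : ℕ) [NeZero r] : IsPrimitiveRoot (zeta r) r :=
  Complex.isPrimitiveRoot_exp r (NeZero.ne r)

/-- A square matrix is monomial if it has a unique nonzero entry in every row and column. -/
def IsMonomial {n : ℕ} (A : Matrix (Fin n) (Fin n) ℂ) : Prop :=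
  (∀ i, ∃! j, A i j ≠ 0) ∧ (∀ j, ∃! i, A i j ≠ 0)

/-- Monomial matrices whose nonzero entries are powers of `ζ`. -/
def IsColoredPerm (r : ℕ) {n : ℕ} (A : Matrix (Fin n) (Fin n) ℂ) : Prop :=
  IsMonomial A ∧ ∀ i j, A i j ≠ 0 → ∃ c : ℤ, A i j = zeta r ^ c

theorem isColoredPerm_iff {r n : ℕ} (A : Matrix (Fin n) (Fin n) ℂ) :
    IsColoredPerm r A ↔ ∃ (s : Equiv.Perm (Fin n)) (c : Fin n → ℤ),
      ∀ i j, A i j = if i = s j then zeta r ^ c j else 0 := by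
  constructor
  · rintro ⟨⟨hrow, hcol⟩, hc⟩
    choose s hs hs' using hcol
    choose t ht ht' using hrow
    have hts : ∀ j, t (s j) = j := fun j => (ht' (s j) j (hs j)).symm
    have hst : ∀ i, s (t i) = i := fun i => (hs' (t i) i (ht i)).symm
    choose c hcc using fun j => hc (s j) j (hs j)
    refine ⟨⟨s, t, hts, hst⟩, c, fun i j => ?_⟩
    simp only [Equiv.coe_fn_mk]
    split_ifs with h
    · rw [h, hcc]
    · by_contra h0
      exact h (hs' j i h0)
  · rintro ⟨s, c, h⟩
    have hz : ∀ j, zeta r ^ c j ≠ 0 := fun j => zpow_ne_zero _ (zeta_ne_zero r)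
    refine ⟨⟨fun i => ⟨s.symm i, ?_, ?_⟩, fun j => ⟨s j, ?_, ?_⟩⟩, ?_⟩
    · simp [h, hz]
    · intro j hj
      by_contra hne
      apply hj
      rw [h, if_neg]
      rintro rfl
      simp at hne
    · simp [h, hz]
    · intro i hi
      by_contra hne
      exact hi (by rw [h, if_neg hne])
    · intro i j hij
      rw [h] at hij ⊢
      split_ifs at hij ⊢ with h1
      · exact ⟨_, rfl⟩
      · exact absurd rfl hij

/-- The reflection group `G_n = G(r,1,n)` of monomial matrices with nonzero entries in `⟨ζ⟩`. -/
def Gn (r n : ℕ) : Subgroup (GL (Fin n) ℂ) where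
  carrier := {g | IsColoredPerm r (g : Matrix (Fin n) (Fin n) ℂ)}
  one_mem' := by
    rw [Set.mem_ofPred_eq, isColoredPerm_iff]
    exact ⟨1, 0, fun i j => by simp [Matrix.one_apply]⟩
  mul_mem' := by
    intro a b ha hb
    rw [Set.mem_ofPred_eq, isColoredPerm_iff] at *
    obtain ⟨s, c, h⟩ := ha
    obtain ⟨t, d, h'⟩ := hb
    refine ⟨s * t, fun j => c (t j) + d j, fun i j => ?_⟩
    simp only [Units.val_mul, Matrix.mul_apply, h, h', Equiv.Perm.mul_apply]
    rw [Finset.sum_eq_single (t j)]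
    · simp [zpow_add₀ (zeta_ne_zero r)]
    · intro b _ hb
      simp [hb]
    · simp
  inv_mem' := by
    intro a ha
    rw [Set.mem_ofPred_eq, isColoredPerm_iff] at *
    obtain ⟨s, c, h⟩ := ha
    refine ⟨s⁻¹, fun j => -c (s⁻¹ j), fun i j => ?_⟩
    have key : ((a * a⁻¹ : GL (Fin n) ℂ) : Matrix (Fin n) (Fin n) ℂ) (s i) j
        = (1 : Matrix (Fin n) (Fin n) ℂ) (s i) j := by simp
    rw [Units.val_mul, Matrix.mul_apply, Finset.sum_eq_single i] at key
    · rw [h, if_pos rfl, Matrix.one_apply] at key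
      have hz : zeta r ^ c i ≠ 0 := zpow_ne_zero _ (zeta_ne_zero r)
      by_cases hij : s i = j
      · subst hij
        simp only [if_true] at key
        simp [eq_inv_of_mul_eq_one_right key]
      · rw [if_neg hij] at key
        rw [if_neg (by rintro rfl; simp at hij)]
        exact (mul_eq_zero.mp key).resolve_left hz
    · intro b _ hb
      rw [h, if_neg (fun e => hb (s.injective e).symm), zero_mul]
    · simp

theorem Gn_form {r n : ℕ} (g : Gn r n) : ∃ (s : Equiv.Perm (Fin n)) (c : Fin n → ℤ),
    ∀ i j, g.1 i j = if i = s j then zeta r ^ c j else 0 :=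
  (isColoredPerm_iff _).1 g.2

/-! ### The action on polynomials -/

/-- The action of a matrix group element on `ℂ[x₁, …, xₙ]` by linear substitutions,
`(g · f)(v) = f (g⁻¹ v)`; so `π · x_i = x_{π(i)}` for a permutation matrix `π`, and
`g · x_i = g_i⁻¹ x_i` for a diagonal matrix `g`. -/
def polyAct {n : ℕ} (g : GL (Fin n) ℂ) : MvPolynomial (Fin n) ℂ →ₐ[ℂ] MvPolynomial (Fin n) ℂ :=
  aeval fun i => ∑ j, C ((g⁻¹ : GL (Fin n) ℂ) i j) * X j

theorem polyAct_one {n : ℕ} : polyAct (1 : GL (Fin n) ℂ) = AlgHom.id ℂ _ := by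
  apply MvPolynomial.algHom_ext
  intro i
  simp [polyAct, Matrix.one_apply, apply_ite C, ite_mul]

theorem polyAct_mul {n : ℕ} (g h : GL (Fin n) ℂ) :
    polyAct (g * h) = (polyAct g).comp (polyAct h) := by
  apply MvPolynomial.algHom_ext
  intro i
  simp only [polyAct, aeval_X, AlgHom.comp_apply, map_sum, map_mul, mul_inv_rev, Units.val_mul,
    Matrix.mul_apply, algHom_C, Finset.sum_mul, Finset.mul_sum, MvPolynomial.algebraMap_eq]
  rw [Finset.sum_comm]
  simp only [mul_assoc]

/-- The ideal `I` is stable under `G_n`. -/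
def IsStable (r : ℕ) {n : ℕ} (I : Ideal (MvPolynomial (Fin n) ℂ)) : Prop :=
  ∀ g : Gn r n, I ≤ I.comap (polyAct g.1)

/-- The (ungraded) `G_n`-module `ℂ[x₁, …, xₙ] / I` for a `G_n`-stable ideal `I`. -/
def quotientRep {r n : ℕ} (I : Ideal (MvPolynomial (Fin n) ℂ)) (hI : IsStable r I) :
    Representation ℂ (Gn r n) (MvPolynomial (Fin n) ℂ ⧸ I) where
  toFun g := (Ideal.quotientMapₐ I (polyAct g.1) (hI g)).toLinearMap
  map_one' := by
    refine LinearMap.ext fun x => ?_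
    obtain ⟨f, rfl⟩ := Ideal.Quotient.mk_surjective x
    exact congrArg (Ideal.Quotient.mk I) (DFunLike.congr_fun polyAct_one f)
  map_mul' g h := by
    refine LinearMap.ext fun x => ?_
    obtain ⟨f, rfl⟩ := Ideal.Quotient.mk_surjective x
    exact congrArg (Ideal.Quotient.mk I) (DFunLike.congr_fun (polyAct_mul g.1 h.1) f)

/-! ### The ideals and the quotient rings -/

/-- `e_d(x₁^r, …, xₙ^r)`. -/
def esymmPow (r n d : ℕ) : MvPolynomial (Fin n) ℂ := expand r (esymm (Fin n) ℂ d)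

/-- The ideal generated by `x₁^m, …, xₙ^m` and `e_d(x₁^r, …, xₙ^r)` for `n - k + 1 ≤ d ≤ n`. -/
def genIdeal (r n k m : ℕ) : Ideal (MvPolynomial (Fin n) ℂ) :=
  Ideal.span (Set.range (fun i : Fin n => (X i : MvPolynomial (Fin n) ℂ) ^ m) ∪
    esymmPow r n '' Set.Icc (n - k + 1) n)

/-- `I_{n,k} = ⟨x₁^{kr+1}, …, xₙ^{kr+1}, e_n(x^r), …, e_{n-k+1}(x^r)⟩`. -/
def idealI (r n k : ℕ) : Ideal (MvPolynomial (Fin n) ℂ) := genIdeal r n k (k * r + 1)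

/-- `J_{n,k} = ⟨x₁^{kr}, …, xₙ^{kr}, e_n(x^r), …, e_{n-k+1}(x^r)⟩`. -/
def idealJ (r n k : ℕ) : Ideal (MvPolynomial (Fin n) ℂ) := genIdeal r n k (k * r)

theorem polyAct_X {r n : ℕ} (g : Gn r n) : ∃ (s : Equiv.Perm (Fin n)) (c : Fin n → ℤ),
    ∀ i, polyAct g.1 (X i) = C (zeta r ^ c i) * X (s i) := by
  obtain ⟨s, c, h⟩ := Gn_form g⁻¹
  refine ⟨s⁻¹, fun i => c (s⁻¹ i), fun i => ?_⟩
  have h' : ∀ i j, ((g.1⁻¹ : GL (Fin n) ℂ) : Matrix (Fin n) (Fin n) ℂ) i j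
      = if i = s j then zeta r ^ c j else 0 := h
  simp only [polyAct, aeval_X, h']
  rw [Finset.sum_eq_single (s⁻¹ i)]
  · simp
  · intro b _ hb
    rw [if_neg (by rintro rfl; simp at hb)]
    simp
  · simp

theorem zeta_zpow_pow (r : ℕ) [NeZero r] (c : ℤ) : (zeta r ^ c) ^ r = 1 := by
  rw [← zpow_natCast, ← zpow_mul, mul_comm, zpow_mul, zpow_natCast, (zeta_primitive r).pow_eq_one,
    one_zpow]

theorem polyAct_esymmPow {r n : ℕ} [NeZero r] (g : Gn r n) (d : ℕ) :
    polyAct g.1 (esymmPow r n d) = esymmPow r n d := by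
  obtain ⟨s, c, h⟩ := polyAct_X g
  have key : (polyAct g.1).comp (expand r) = (expand r).comp (rename (R := ℂ) s) := by
    apply MvPolynomial.algHom_ext
    intro i
    simp only [AlgHom.comp_apply, expand_X, map_pow, h, rename_X, mul_pow]
    rw [← map_pow C, zeta_zpow_pow, C_1, one_mul]
  have := DFunLike.congr_fun key (esymm (Fin n) ℂ d)
  simp only [AlgHom.comp_apply, rename_esymm] at this
  exact this

theorem genIdeal_stable (r n k m : ℕ) [NeZero r] : IsStable r (genIdeal r n k m) := by
  intro g
  rw [genIdeal, Ideal.span_le]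
  rintro f (⟨i, rfl⟩ | ⟨d, hd, rfl⟩)
  · obtain ⟨s, c, h⟩ := polyAct_X g
    simp only [SetLike.mem_coe, Ideal.mem_comap, map_pow, h, mul_pow]
    exact Ideal.mul_mem_left _ _ (Ideal.subset_span (Or.inl ⟨s i, rfl⟩))
  · simp only [SetLike.mem_coe, Ideal.mem_comap, polyAct_esymmPow]
    exact Ideal.subset_span (Or.inr ⟨d, hd, rfl⟩)

/-- The `G_n`-module `R_{n,k} = ℂ[x₁, …, xₙ] / I_{n,k}`. -/
def repR (r n k : ℕ) [NeZero r] :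
    Representation ℂ (Gn r n) (MvPolynomial (Fin n) ℂ ⧸ idealI r n k) :=
  quotientRep (idealI r n k) (genIdeal_stable r n k _)

/-- The `G_n`-module `S_{n,k} = ℂ[x₁, …, xₙ] / J_{n,k}`. -/
def repS (r n k : ℕ) [NeZero r] :
    Representation ℂ (Gn r n) (MvPolynomial (Fin n) ℂ ⧸ idealJ r n k) :=
  quotientRep (idealJ r n k) (genIdeal_stable r n k _)

/-! ### Faces and colored ordered set partitions -/

/-- A `k`-dimensional `G_n`-face `(Z ∣ B₁ ∣ ⋯ ∣ B_k)`: an ordered set partition of `[n]` into a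
possibly empty (that is, absent) uncolored zero block `Z` and `k` nonempty blocks of letters that
carry colors in `{0, …, r-1}`. The element `(i, c)` stands for the colored letter `i^c`. -/
@[ext]
structure Face (r n k : ℕ) where
  zeroBlock : Set (Fin n)
  block : Fin k → Set (Fin n × Fin r)
  nonempty : ∀ j, (block j).Nonempty
  /-- Every letter lies either in the zero block only, or in exactly one of the other blocks, where
  it occurs with exactly one color. -/
  partition : ∀ i, (i ∈ zeroBlock ∧ ∀ j c, (i, c) ∉ block j) ∨
    (i ∉ zeroBlock ∧ ∃! p : Fin k × Fin r, (i, p.2) ∈ block p.1)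

/-- The image of a set of uncolored letters under `g`: the letter `i` goes to the position of the
nonzero entry in column `i` of `g`. -/
def mapLetters {n : ℕ} (g : Matrix (Fin n) (Fin n) ℂ) (Z : Set (Fin n)) : Set (Fin n) :=
  {i' | ∃ i ∈ Z, g i' i ≠ 0}

/-- The image of a set of colored letters under `g`: the letter `i^c` goes to `i'^{c'}`, where
`g` maps `ζ^c e_i` to `ζ^{c'} e_{i'}`. -/
def mapColored {r n : ℕ} (g : Matrix (Fin n) (Fin n) ℂ) (B : Set (Fin n × Fin r)) :
    Set (Fin n × Fin r) :=
  {p' | ∃ p ∈ B, g p'.1 p.1 * zeta r ^ (p.2 : ℕ) = zeta r ^ (p'.2 : ℕ)}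

theorem zeta_pow_inj {r : ℕ} [NeZero r] {c d : Fin r}
    (h : zeta r ^ (c : ℕ) = zeta r ^ (d : ℕ)) : c = d :=
  Fin.ext ((zeta_primitive r).pow_inj c.2 d.2 h)

theorem exists_color {r : ℕ} [NeZero r] (m : ℤ) (c : Fin r) :
    ∃ d : Fin r, zeta r ^ m * zeta r ^ (c : ℕ) = zeta r ^ (d : ℕ) := by
  have h : (zeta r ^ m * zeta r ^ (c : ℕ)) ^ r = 1 := by
    rw [mul_pow, zeta_zpow_pow, one_mul, ← zpow_natCast (zeta r), zeta_zpow_pow]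
  obtain ⟨d, hd, h⟩ := (zeta_primitive r).eq_pow_of_pow_eq_one h
  exact ⟨⟨d, hd⟩, h.symm⟩

/-- The action of `g` on letters and colored letters is by permutations. -/
theorem exists_perms {r n : ℕ} [NeZero r] (g : Gn r n) : ∃ (s : Equiv.Perm (Fin n))
    (t : Fin n → Equiv.Perm (Fin r)), (∀ i' i, g.1 i' i ≠ 0 ↔ i' = s i) ∧
    ∀ (i' : Fin n) (c' : Fin r) (i : Fin n) (c : Fin r), (g.1 i' i * zeta r ^ (c : ℕ) = zeta r ^ (c' : ℕ) ↔ i' = s i ∧ c' = t i c) := by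
  obtain ⟨s, m, h⟩ := Gn_form g
  choose t ht using fun (i : Fin n) (c : Fin r) => exists_color (r := r) (m i) c
  have hz : ∀ i, zeta r ^ m i ≠ 0 := fun i => zpow_ne_zero _ (zeta_ne_zero r)
  have hinj : ∀ i, Function.Injective (t i) := fun i c d hcd => by
    have : zeta r ^ m i * zeta r ^ (c : ℕ) = zeta r ^ m i * zeta r ^ (d : ℕ) := by
      rw [ht, ht, hcd]
    exact zeta_pow_inj (mul_left_cancel₀ (hz i) this)
  refine ⟨s, fun i => Equiv.ofBijective (t i) (Finite.injective_iff_bijective.1 (hinj i)),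
    fun i' i => ?_, fun i' c' i c => ?_⟩
  · rw [h]
    by_cases e : i' = s i <;> simp [e, hz]
  · rw [h]
    by_cases e : i' = s i
    · simp only [e, if_true, ht, true_and, Equiv.ofBijective_apply]
      exact ⟨fun h => (zeta_pow_inj h).symm, fun h => by rw [h]⟩
    · simp only [e, if_false, zero_mul, false_and, iff_false]
      exact fun h => pow_ne_zero _ (zeta_ne_zero r) h.symm

theorem mapLetters_one {n : ℕ} (Z : Set (Fin n)) : mapLetters 1 Z = Z := by
  ext i
  simp [mapLetters, Matrix.one_apply]

theorem mapColored_one {r n : ℕ} [NeZero r] (B : Set (Fin n × Fin r)) : mapColored 1 B = B := by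
  ext ⟨i, c⟩
  constructor
  · rintro ⟨⟨i', c'⟩, hp, h⟩
    simp only [Matrix.one_apply] at h
    split_ifs at h with e
    · rw [one_mul] at h
      rw [e, ← zeta_pow_inj h]
      exact hp
    · rw [zero_mul] at h
      exact absurd h.symm (pow_ne_zero _ (zeta_ne_zero r))
  · intro h
    exact ⟨_, h, by simp⟩

theorem mapLetters_mul {r n : ℕ} (g h : Gn r n) (Z : Set (Fin n)) :
    mapLetters ((g * h : Gn r n).1 : Matrix (Fin n) (Fin n) ℂ) Z
      = mapLetters g.1 (mapLetters h.1 Z) := by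
  obtain ⟨t, d, ht⟩ := Gn_form h
  have hz : ∀ i, zeta r ^ d i ≠ 0 := fun i => zpow_ne_zero _ (zeta_ne_zero r)
  ext i
  simp only [mapLetters, Set.mem_ofPred_eq, Subgroup.coe_mul, Units.val_mul, Matrix.mul_apply, ht,
    mul_ite, mul_zero, Finset.sum_ite_eq', Finset.mem_univ, if_true]
  constructor
  · rintro ⟨j, hj, h⟩
    exact ⟨t j, ⟨j, hj, by simp [hz]⟩, left_ne_zero_of_mul h⟩
  · rintro ⟨_, ⟨j, hj, h⟩, h'⟩
    have e := (ite_ne_right_iff.1 h).1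
    exact ⟨j, hj, mul_ne_zero (e ▸ h') (hz j)⟩

theorem mapColored_mul {r n : ℕ} [NeZero r] (g h : Gn r n) (B : Set (Fin n × Fin r)) :
    mapColored ((g * h : Gn r n).1 : Matrix (Fin n) (Fin n) ℂ) B
      = mapColored g.1 (mapColored h.1 B) := by
  obtain ⟨t, d, ht⟩ := Gn_form h
  ext ⟨i, c⟩
  simp only [mapColored, Set.mem_ofPred_eq, Subgroup.coe_mul, Units.val_mul, Matrix.mul_apply, ht,
    mul_ite, mul_zero, Finset.sum_ite_eq', Finset.mem_univ, if_true]
  constructor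
  · rintro ⟨⟨j, e⟩, hj, h⟩
    obtain ⟨f, hf⟩ := exists_color (d j) e
    refine ⟨(t j, f), ⟨_, hj, by simpa using hf⟩, ?_⟩
    rw [← h, ← hf, mul_assoc]
  · rintro ⟨⟨l, f⟩, ⟨⟨j, e⟩, hj, h⟩, h'⟩
    simp only at h h'
    by_cases el : l = t j
    · rw [if_pos el] at h
      refine ⟨_, hj, ?_⟩
      rw [← h', ← h, el, mul_assoc]
    · rw [if_neg el, zero_mul] at h
      exact absurd h.symm (pow_ne_zero _ (zeta_ne_zero r))

/-- `G_n` acts on the faces through its action on letters and colored letters, letters of the zero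
block staying uncolored. -/
instance (r n k : ℕ) [NeZero r] : MulAction (Gn r n) (Face r n k) where
  smul g σ :=
    { zeroBlock := mapLetters g.1 σ.zeroBlock
      block := fun j => mapColored g.1 (σ.block j)
      nonempty := fun j => by
        obtain ⟨s, t, -, h⟩ := exists_perms g
        obtain ⟨⟨i, c⟩, hp⟩ := σ.nonempty j
        exact ⟨(s i, t i c), (i, c), hp, (h _ _ _ _).2 ⟨rfl, rfl⟩⟩
      partition := fun i' => by
        obtain ⟨s, t, h0, h⟩ := exists_perms g
        obtain ⟨i, rfl⟩ := s.surjective i'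
        have hzero : s i ∈ mapLetters g.1 σ.zeroBlock ↔ i ∈ σ.zeroBlock := by
          simp [mapLetters, h0]
        have hblock : ∀ j c', (s i, c') ∈ mapColored g.1 (σ.block j) ↔
            (i, (t i).symm c') ∈ σ.block j := fun j c' => by
          simp only [mapColored, Set.mem_ofPred_eq, h, s.injective.eq_iff, Prod.exists]
          constructor
          · rintro ⟨a, b, hab, rfl, rfl⟩
            simpa using hab
          · intro hp
            exact ⟨i, _, hp, rfl, by simp⟩
        rcases σ.partition i with ⟨h1, h2⟩ | ⟨h1, ⟨j, c⟩, h2, h3⟩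
        · exact Or.inl ⟨hzero.2 h1, fun j c' => by rw [hblock]; exact h2 _ _⟩
        · refine Or.inr ⟨by rwa [hzero], (j, t i c), ?_, ?_⟩
          · simp only [hblock]
            simpa using h2
          · rintro ⟨j', c'⟩ hp
            simp only [hblock] at hp
            have := h3 (j', (t i).symm c') hp
            simp only [Prod.mk.injEq] at this ⊢
            exact ⟨this.1, (Equiv.symm_apply_eq _).1 this.2⟩ }
  one_smul σ := Face.ext (mapLetters_one _) (funext fun _ => mapColored_one _)
  mul_smul g h σ := Face.ext (mapLetters_mul g h _) (funext fun _ => mapColored_mul g h _)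

/-- The `G_n`-set `OP_{n,k}` of `r`-colored ordered set partitions of `[n]` with `k` blocks: the
`G_n`-faces in which all letters are colored, that is, which have no zero block. -/
def OP (r n k : ℕ) [NeZero r] : SubMulAction (Gn r n) (Face r n k) where
  carrier := {σ | σ.zeroBlock = ∅}
  smul_mem' g σ hσ := by
    change mapLetters g.1 σ.zeroBlock = ∅
    rw [Set.mem_ofPred_eq] at hσ
    simp [hσ, mapLetters]

/-! ### Point sets and ideals of top degree components -/

/-- The point set `Y_{n,k}` attached to `α₁, …, α_k`. -/
def pointsY (r n k : ℕ) (α : Fin k → ℝ) : Set (Fin n → ℂ) :=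
  {y | (∀ i, y i = 0 ∨ ∃ (c : Fin r) (j : Fin k), y i = zeta r ^ (c : ℕ) * (α j : ℂ)) ∧
    Set.range α ⊆ Set.range fun i => ‖y i‖}

/-- The point set `Z_{n,k}`: the points of `Y_{n,k}` without vanishing coordinates. -/
def pointsZ (r n k : ℕ) (α : Fin k → ℝ) : Set (Fin n → ℂ) :=
  {y | y ∈ pointsY r n k α ∧ ∀ i, y i ≠ 0}

/-- The ideal `T(Y)` generated by the top degree homogeneous components `τ(f)` of the nonzero
polynomials `f` vanishing on `Y`. -/
def topIdeal {n : ℕ} (Y : Set (Fin n → ℂ)) : Ideal (MvPolynomial (Fin n) ℂ) :=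
  Ideal.span {p | ∃ f ∈ vanishingIdeal ℂ Y, f ≠ 0 ∧ p = homogeneousComponent f.totalDegree f}

end

end ColoredCoinvariant

namespace ColoredCoinvariant

noncomputable section

open MvPolynomial

/-! ### An upper bound for the dimension of the quotient -/

/-! The argument is orbit harmonics with a dimension count. Sending a face to the point with `i`-th
coordinate `ζ^c α_j` (letter `i` of color `c` in block `j`) or `0` (zero block) is an equivariant
bijection of faces with `Y_{n,k}`, and of faces without zero block with `Z_{n,k}`
(`range_facePoint`, `range_facePoint_OP`, `facePoint_smul`). Both cases run in parallel: the
coordinates lie in a finite set `W` with `kr + 1` or `kr` elements, and each `b_j = α_j^r` must be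
the `r`-th power of some coordinate.

Let `I` be the ideal and `Y` the point set. Two facts carry the proof.

Lower bound, `I ≤ T(Y)` (`truncIdeal_le_topIdeal`): `x_i^|W|` is the top component of `∏_{w ∈ W}
(x_i - w)`, and `e_d(x^r)` with `d > n - k` is the top component of a linear combination of the
polynomials `∏_i (x_i^r - b_j)`, whose coefficients come from an inverse Vandermonde matrix.

Upper bound, `ℂ[x]/I` is spanned by `|Y|` elements (`spannedBy_truncIdeal`, `card_hitPoints`):
filtering by powers of `x_0` bounds the dimension by the recursion that counts the points of `Y` by
their first coordinate.

Since `I` is homogeneous and stable, there is a projection `p` with kernel `I` that preserves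
degrees and commutes with the group. Because `I ≤ T(Y)`, replacing a homogeneous `f` by `p f`
changes its values on `Y` only by those of a polynomial of lower degree, so evaluation on `Y`
remains surjective after composing with `p`. By the upper bound the composite has kernel exactly
`I`. This gives both the isomorphism of modules and `T(Y) ≤ I`. -/

theorem esymmPow_zero (r n : ℕ) : esymmPow r n 0 = 1 := by
  simp [esymmPow]

theorem esymmPow_eq_zero {r n d : ℕ} (h : n < d) : esymmPow r n d = 0 := by
  rw [esymmPow, esymm, Finset.powersetCard_eq_empty.2 (by simpa using h)]
  simp

/-- The `d + 1`-subsets are split according to whether they contain the index `0`. -/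
theorem esymmPow_succ (r n d : ℕ) : esymmPow r (n + 1) (d + 1) =
    rename Fin.succ (esymmPow r n (d + 1)) + X 0 ^ r * rename Fin.succ (esymmPow r n d) := by
  have key : esymm (Fin (n + 1)) ℂ (d + 1) =
      rename Fin.succ (esymm (Fin n) ℂ (d + 1)) + X 0 * rename Fin.succ (esymm (Fin n) ℂ d) := by
    simp only [esymm, map_sum, map_prod, rename_X]
    rw [Fin.univ_succ, Finset.cons_eq_insert, Finset.powersetCard_succ_insert (by simp),
      Finset.sum_union, Finset.sum_image, Finset.powersetCard_map, Finset.powersetCard_map,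
      Finset.sum_map, Finset.sum_map, Finset.mul_sum]
    · congr 1
      · simp [Finset.prod_map]
      · refine Finset.sum_congr rfl fun t _ => ?_
        rw [Finset.prod_insert (by simp)]
        simp [Finset.prod_map]
    · intro s hs t ht hst
      have h0 : ∀ u ∈ Finset.powersetCard d (Finset.map ⟨Fin.succ, Fin.succ_injective n⟩
          Finset.univ), (0 : Fin (n + 1)) ∉ u := fun u hu h => by
        have := (Finset.mem_powersetCard.1 hu).1 h
        simp at this
      rw [← Finset.erase_insert (h0 s hs), ← Finset.erase_insert (h0 t ht), hst]
    · rw [Finset.disjoint_left]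
      intro s hs hs'
      obtain ⟨t, -, rfl⟩ := Finset.mem_image.1 hs'
      have := (Finset.mem_powersetCard.1 hs).1 (Finset.mem_insert_self 0 t)
      simp at this
  simp only [esymmPow, key, map_add, map_mul, expand_X, rename_expand]

/-- The ideal generated by `x_i ^ m` and by `e_d(x₁^r, …, xₙ^r)` for `d > n - k`. -/
def truncIdeal (r n k m : ℕ) : Ideal (MvPolynomial (Fin n) ℂ) :=
  Ideal.span (Set.range (fun i : Fin n => (X i : MvPolynomial (Fin n) ℂ) ^ m) ∪
    esymmPow r n '' {d | n < d + k})

theorem X_pow_mem_truncIdeal (r : ℕ) {n : ℕ} (k : ℕ) {m j : ℕ} (i : Fin n) (h : m ≤ j) :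
    (X i : MvPolynomial (Fin n) ℂ) ^ j ∈ truncIdeal r n k m := by
  rw [← Nat.add_sub_cancel' h, pow_add]
  exact Ideal.mul_mem_right _ _ (Ideal.subset_span (Or.inl ⟨i, rfl⟩))

theorem esymmPow_mem_truncIdeal (r m : ℕ) {n k d : ℕ} (h : n < d + k) :
    esymmPow r n d ∈ truncIdeal r n k m :=
  Ideal.subset_span (Or.inr ⟨d, h, rfl⟩)

/-- For `k > n` the two ideals may differ: the condition `n < d + k` then admits `d = 0`, hence `e_0
= 1`, while the truncated `n - k + 1` starts at `1`. The recursion on `n` passes through such `k`,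
and there the quotient has to be zero. -/
theorem genIdeal_eq_truncIdeal {r n k m : ℕ} (hk : k ≤ n) :
    genIdeal r n k m = truncIdeal r n k m := by
  refine le_antisymm (Ideal.span_mono (Set.union_subset_union_right _
    (Set.image_mono fun d hd => ?_))) (Ideal.span_le.2 (Set.union_subset ?_ ?_))
  · have := hd.1
    simp only [Set.mem_ofPred_eq]
    omega
  · exact fun f hf => Ideal.subset_span (Or.inl hf)
  · rintro _ ⟨d, hd, rfl⟩
    rw [Set.mem_ofPred_eq] at hd
    by_cases h : d ≤ n
    · exact Ideal.subset_span (Or.inr ⟨d, ⟨by omega, h⟩, rfl⟩)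
    · rw [esymmPow_eq_zero (by omega)]
      exact zero_mem _

/-- Modulo the ideal, `x_0^r e_d(x') = -e_{d+1}(x')`, where `x'` omits `x_0` and exponents `r` are
understood. Each factor `x_0^r` thus raises the index by one, and after `t` steps it exceeds the
number of variables. -/
theorem X_zero_pow_mul_rename_esymmPow_mem {r n k m d t : ℕ} (hd : n + 1 ≤ d + t) (ht : t ≤ k) :
    X 0 ^ (t * r) * rename Fin.succ (esymmPow r n d) ∈ truncIdeal r (n + 1) k m := by
  induction t generalizing d with
  | zero => simp [esymmPow_eq_zero (r := r) (show n < d by omega)]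
  | succ t ih =>
    have h : X 0 ^ ((t + 1) * r) * rename Fin.succ (esymmPow r n d) =
        X 0 ^ (t * r) * esymmPow r (n + 1) (d + 1) -
          X 0 ^ (t * r) * rename Fin.succ (esymmPow r n (d + 1)) := by
      rw [esymmPow_succ]
      ring
    rw [h]
    exact sub_mem (Ideal.mul_mem_left _ _ (esymmPow_mem_truncIdeal r m (by omega)))
      (ih (by omega) (by omega))

/-- This controls the layer `x_0^j` of the filtration by powers of `x_0`: relations in one variable
less with parameter `k - 1` hold in every layer, and those with parameter `k` hold once `j ≥ kr`. -/
theorem X_zero_pow_mul_rename_mem {r n k m j l : ℕ} (hr : 0 < r)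
    (hl : l + 1 = k ∨ (l = k ∧ k * r ≤ j))
    {f : MvPolynomial (Fin n) ℂ} (hf : f ∈ truncIdeal r n l m) :
    X 0 ^ j * rename Fin.succ f ∈
      truncIdeal r (n + 1) k m ⊔ Ideal.span {(X 0 : MvPolynomial (Fin (n + 1)) ℂ) ^ (j + 1)} := by
  set U := truncIdeal r (n + 1) k m ⊔ Ideal.span {(X 0 : MvPolynomial (Fin (n + 1)) ℂ) ^ (j + 1)}
  have hI : truncIdeal r (n + 1) k m ≤ U := le_sup_left
  have hX : ∀ g, X 0 ^ (j + 1) * g ∈ U := fun g => Ideal.mul_mem_right _ _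
    ((le_sup_right : _ ≤ U) (Ideal.mem_span_singleton_self _))
  induction hf using Submodule.closure_induction with
  | zero => simp
  | add f g _ _ hf hg =>
    rw [map_add, mul_add]
    exact add_mem hf hg
  | smul_mem a f hf =>
    rw [smul_eq_mul, map_mul, mul_left_comm]
    refine Ideal.mul_mem_left _ _ ?_
    -- Here `e_d` of all the variables lies in the ideal, and it differs from `e_d(x')` by a
    -- multiple of `x_0^r`, which is absorbed by `x_0^(j+1)` because `r ≥ 1`.
    have high : ∀ d, n + 1 < d + k →
        X 0 ^ j * rename Fin.succ (esymmPow r n d) ∈ U := fun d hd => by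
      rcases d with _ | d
      · rw [esymmPow_zero, map_one, ← esymmPow_zero r (n + 1)]
        exact hI (Ideal.mul_mem_left _ _ (esymmPow_mem_truncIdeal r m hd))
      · obtain ⟨s, rfl⟩ := Nat.exists_eq_add_of_lt hr
        have h : X 0 ^ j * rename Fin.succ (esymmPow (0 + s + 1) n (d + 1)) =
            X 0 ^ j * esymmPow (0 + s + 1) (n + 1) (d + 1) -
              X 0 ^ (j + 1) * (X 0 ^ s * rename Fin.succ (esymmPow (0 + s + 1) n d)) := by
          rw [esymmPow_succ]
          ring
        rw [h]
        exact sub_mem (hI (Ideal.mul_mem_left _ _ (esymmPow_mem_truncIdeal _ m hd))) (hX _)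
    rcases hf with ⟨i, rfl⟩ | ⟨d, hd, rfl⟩
    · simp only [map_pow, rename_X]
      exact hI (Ideal.mul_mem_left _ _ (X_pow_mem_truncIdeal r k _ le_rfl))
    · rw [Set.mem_ofPred_eq] at hd
      rcases hl with rfl | ⟨rfl, hj⟩
      · exact high d (by omega)
      · rcases Nat.lt_or_ge (n + 1) (d + l) with h | h
        · exact high d h
        -- The only remaining index is `d = n + 1 - k`, where the factor `x_0^(kr)` is needed in
        -- full.
        · obtain ⟨s, rfl⟩ := Nat.exists_eq_add_of_le hj
          rw [add_comm (l * r), pow_add, mul_assoc]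
          exact hI (Ideal.mul_mem_left _ _
            (X_zero_pow_mul_rename_esymmPow_mem (by omega) le_rfl))

theorem exists_eq_rename_succ_add {n : ℕ} (f : MvPolynomial (Fin (n + 1)) ℂ) :
    ∃ g h, f = rename Fin.succ g + X 0 * h := by
  induction f using MvPolynomial.induction_on with
  | C a => exact ⟨C a, 0, by simp⟩
  | add p q hp hq =>
    obtain ⟨g, h, rfl⟩ := hp
    obtain ⟨g', h', rfl⟩ := hq
    exact ⟨g + g', h + h', by rw [map_add]; ring⟩
  | mul_X p i hp =>
    obtain ⟨g, h, rfl⟩ := hp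
    refine Fin.cases ⟨0, rename Fin.succ g + X 0 * h, by rw [map_zero]; ring⟩ (fun i => ?_) i
    exact ⟨g * X i, h * X i.succ, by rw [map_mul, rename_X]; ring⟩

/-- The number of maps from an `n`-element set to an `m`-element set that meet each of `k` given
disjoint `r`-element subsets. -/
def hitCount (r m : ℕ) : ℕ → ℕ → ℕ
  | 0, 0 => 1
  | 0, _ + 1 => 0
  | n + 1, 0 => m * hitCount r m n 0
  | n + 1, k + 1 => (k + 1) * r * hitCount r m n k + (m - (k + 1) * r) * hitCount r m n (k + 1)

/-- Some set of at most `N` polynomials spans the polynomial ring together with the ideal `I`. -/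
def SpannedBy {σ : Type*} (I : Ideal (MvPolynomial σ ℂ)) (N : ℕ) : Prop :=
  ∃ S : Finset (MvPolynomial σ ℂ), S.card ≤ N ∧
    Submodule.span ℂ (S : Set (MvPolynomial σ ℂ)) ⊔ I.restrictScalars ℂ = ⊤

/-- Spanning sets `S j` for the layers are lifted by multiplication with `x_0^j`; the layers `j ≥ m`
vanish because `x_0^m` lies in the ideal. -/
theorem spannedBy_succ {r n k m : ℕ} (hr : 0 < r) (S : ℕ → Finset (MvPolynomial (Fin n) ℂ))
    (hS : ∀ j < m, ∃ l, (l + 1 = k ∨ (l = k ∧ k * r ≤ j)) ∧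
      Submodule.span ℂ (S j : Set (MvPolynomial (Fin n) ℂ)) ⊔
        (truncIdeal r n l m).restrictScalars ℂ = ⊤) :
    SpannedBy (truncIdeal r (n + 1) k m) (∑ j ∈ Finset.range m, (S j).card) := by
  classical
  let T : Finset (MvPolynomial (Fin (n + 1)) ℂ) := (Finset.range m).biUnion fun j =>
    (S j).image fun s => X 0 ^ j * rename Fin.succ s
  refine ⟨T, Finset.card_biUnion_le.trans (Finset.sum_le_sum fun j _ => Finset.card_image_le), ?_⟩
  set U := Submodule.span ℂ (T : Set (MvPolynomial (Fin (n + 1)) ℂ)) ⊔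
    (truncIdeal r (n + 1) k m).restrictScalars ℂ with hU
  have hI : ∀ f ∈ truncIdeal r (n + 1) k m, f ∈ U := fun f hf =>
    (le_sup_right : _ ≤ U) hf
  -- Descending induction on the exponent `j`, with `t` bounding the distance to `m`.
  have main : ∀ t j, m ≤ j + t → ∀ g, X 0 ^ j * g ∈ U := by
    intro t
    induction t with
    | zero =>
      intro j hj g
      exact hI _ (Ideal.mul_mem_right _ _ (X_pow_mem_truncIdeal r k 0 hj))
    | succ t ih =>
      intro j hj g
      rcases Nat.lt_or_ge j m with hjm | hjm
      swap
      · exact hI _ (Ideal.mul_mem_right _ _ (X_pow_mem_truncIdeal r k 0 hjm))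
      have ih' := ih (j + 1) (by omega)
      obtain ⟨g, h, rfl⟩ := exists_eq_rename_succ_add g
      rw [mul_add, ← mul_assoc, ← pow_succ]
      refine add_mem ?_ (ih' h)
      obtain ⟨l, hl, hspan⟩ := hS j hjm
      have hg : g ∈ Submodule.span ℂ (S j : Set (MvPolynomial (Fin n) ℂ)) ⊔
        (truncIdeal r n l m).restrictScalars ℂ := hspan ▸ Submodule.mem_top
      obtain ⟨s, hs, f, hf, rfl⟩ := Submodule.mem_sup.1 hg
      rw [map_add, mul_add]
      refine add_mem ?_ ?_
      · induction hs using Submodule.span_induction with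
        | zero => simp
        | add x y _ _ hx hy =>
          rw [map_add, mul_add]
          exact add_mem (hx (hspan ▸ Submodule.mem_top)) (hy (hspan ▸ Submodule.mem_top))
        | smul c x _ hx =>
          rw [map_smul, mul_smul_comm]
          exact U.smul_mem c (hx (hspan ▸ Submodule.mem_top))
        | mem x hx =>
          exact (le_sup_left : _ ≤ U) (Submodule.subset_span (Finset.mem_biUnion.2
            ⟨j, Finset.mem_range.2 hjm, Finset.mem_image_of_mem _ hx⟩))
      · have := X_zero_pow_mul_rename_mem hr hl (Submodule.restrictScalars_mem ℂ _ _ |>.1 hf)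
        obtain ⟨a, ha, b, hb, hab⟩ := Submodule.mem_sup.1 this
        obtain ⟨c, rfl⟩ := Ideal.mem_span_singleton'.1 hb
        rw [← hab, mul_comm c]
        exact add_mem (hI _ ha) (ih' c)
  rw [eq_top_iff]
  intro g _
  simpa using main m 0 (by omega) g

theorem spannedBy_truncIdeal {r : ℕ} (hr : 0 < r) {n k m : ℕ} (hm : k * r ≤ m) :
    SpannedBy (truncIdeal r n k m) (hitCount r m n k) := by
  induction n generalizing k with
  | zero =>
    rcases k with _ | k
    · refine ⟨{1}, by simp [hitCount], ?_⟩
      rw [eq_top_iff]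
      intro f _
      refine Submodule.mem_sup_left ?_
      rw [MvPolynomial.eq_C_of_isEmpty f, C_eq_smul_one]
      exact Submodule.smul_mem _ _ (Submodule.subset_span (by simp))
    · refine ⟨∅, by simp, ?_⟩
      rw [eq_top_iff]
      intro f _
      refine Submodule.mem_sup_right ?_
      have h : (1 : MvPolynomial (Fin 0) ℂ) ∈ truncIdeal r 0 (k + 1) m := by
        rw [← esymmPow_zero r 0]
        exact esymmPow_mem_truncIdeal r m (by omega)
      rw [(Ideal.eq_top_iff_one _).2 h]
      trivial
  | succ n ih =>
    obtain ⟨S, hS, hS'⟩ := ih hm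
    rcases k with _ | k
    · obtain ⟨T, hT, hT'⟩ := spannedBy_succ hr (fun _ => S) (fun j (_ : j < m) =>
        ⟨0, Or.inr ⟨rfl, by omega⟩, hS'⟩)
      refine ⟨T, hT.trans ?_, hT'⟩
      rw [Finset.sum_const, Finset.card_range, smul_eq_mul]
      exact Nat.mul_le_mul_left _ hS
    · obtain ⟨S₀, hS₀, hS₀'⟩ := ih (k := k) (le_trans (by gcongr; omega) hm)
      -- The `(k + 1) r` lowest layers use parameter `k`, the other `m - (k + 1) r` use `k + 1`;
      -- these are the two terms in the recursion of `hitCount`.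
      obtain ⟨T, hT, hT'⟩ := spannedBy_succ (k := k + 1) hr
        (fun j => if j < (k + 1) * r then S₀ else S) (fun j (_ : j < m) => by
          by_cases h : j < (k + 1) * r
          · exact ⟨k, Or.inl rfl, by simpa [h] using hS₀'⟩
          · exact ⟨k + 1, Or.inr ⟨rfl, by omega⟩, by simpa [h] using hS'⟩)
      refine ⟨T, hT.trans ?_, hT'⟩
      rw [← Finset.sum_range_add_sum_Ico _ hm, hitCount]
      refine add_le_add ?_ ?_
      · rw [Finset.sum_congr rfl (g := fun _ => S₀.card) fun j hj => by
          rw [if_pos (Finset.mem_range.1 hj)]]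
        simpa using Nat.mul_le_mul_left _ hS₀
      · rw [Finset.sum_congr rfl (g := fun _ => S.card) fun j hj => by
          rw [if_neg (by have := (Finset.mem_Ico.1 hj).1; omega)]]
        simpa using Nat.mul_le_mul_left _ hS

/-! ### Counting points -/

/-- The points with coordinates in `W` such that every element of `B` is the `r`-th power of some
coordinate. -/
def hitPoints (r n : ℕ) (W B : Finset ℂ) : Finset (Fin n → ℂ) :=
  {y ∈ Fintype.piFinset fun _ => W | ∀ b ∈ B, ∃ i, y i ^ r = b}

theorem mem_hitPoints {r n : ℕ} {W B : Finset ℂ} {y : Fin n → ℂ} :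
    y ∈ hitPoints r n W B ↔ (∀ i, y i ∈ W) ∧ ∀ b ∈ B, ∃ i, y i ^ r = b := by
  simp [hitPoints]

/-- A first coordinate `w` fulfils the requirement `b = w^r`, if there is one, and leaves the others
to the remaining coordinates. -/
theorem card_hitPoints_succ (r n : ℕ) (W B : Finset ℂ) :
    (hitPoints r (n + 1) W B).card = ∑ w ∈ W, (hitPoints r n W (B.erase (w ^ r))).card := by
  rw [← Finset.card_sigma]
  symm
  refine Finset.card_bij' (fun p _ => Fin.cons p.1 p.2) (fun y _ => ⟨y 0, Fin.tail y⟩)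
    (fun p hp => ?_) (fun y hy => ?_) (fun p _ => by simp) (fun y _ => by simp)
  · rw [Finset.mem_sigma, mem_hitPoints] at hp
    rw [mem_hitPoints]
    refine ⟨Fin.cases (by simpa using hp.1) (by simpa using hp.2.1), fun b hb => ?_⟩
    by_cases h : p.1 ^ r = b
    · exact ⟨0, by simpa using h⟩
    · obtain ⟨i, hi⟩ := hp.2.2 b (Finset.mem_erase.2 ⟨Ne.symm h, hb⟩)
      exact ⟨i.succ, by simpa using hi⟩
  · rw [mem_hitPoints] at hy
    rw [Finset.mem_sigma, mem_hitPoints]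
    refine ⟨hy.1 0, fun i => hy.1 i.succ, fun b hb => ?_⟩
    rw [Finset.mem_erase] at hb
    obtain ⟨i, hi⟩ := hy.2 b hb.2
    induction i using Fin.cases with
    | zero => exact absurd hi.symm hb.1
    | succ i => exact ⟨i, hi⟩

/-- Exactly `B.card * r` choices of the first coordinate meet a requirement, since each `b` has `r`
roots in `W`. The count therefore obeys the same recursion as the spanning bound. -/
theorem card_hitPoints {r : ℕ} {W B : Finset ℂ}
    (hB : ∀ b ∈ B, (W.filter fun w => w ^ r = b).card = r) (n : ℕ) :
    (hitPoints r n W B).card = hitCount r W.card n B.card := by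
  induction n generalizing B with
  | zero =>
    rcases B.eq_empty_or_nonempty with rfl | ⟨b, hb⟩
    · simp [hitPoints, hitCount]
    · obtain ⟨k, hk⟩ := Nat.exists_eq_succ_of_ne_zero (Finset.card_ne_zero_of_mem hb)
      rw [hk, hitCount, Finset.card_eq_zero, Finset.eq_empty_iff_forall_notMem]
      intro y hy
      obtain ⟨i, -⟩ := (mem_hitPoints.1 hy).2 b hb
      exact i.elim0
  | succ n ih =>
    rw [card_hitPoints_succ]
    have hsum : ∀ w ∈ W, (hitPoints r n W (B.erase (w ^ r))).card =
        if w ^ r ∈ B then hitCount r W.card n (B.card - 1) else hitCount r W.card n B.card := by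
      intro w _
      rw [ih fun b hb => hB b (Finset.mem_of_mem_erase hb)]
      split_ifs with h
      · rw [Finset.card_erase_of_mem h]
      · rw [Finset.erase_eq_of_notMem h]
    have hcard : (W.filter fun w => w ^ r ∈ B).card = B.card * r := by
      have hmaps : Set.MapsTo (fun w : ℂ => w ^ r) (W.filter fun w => w ^ r ∈ B) B :=
        fun w hw => (Finset.mem_filter.1 hw).2
      rw [Finset.card_eq_sum_card_fiberwise hmaps, ← smul_eq_mul, ← Finset.sum_const]
      refine Finset.sum_congr rfl fun b hb => ?_
      rw [Finset.filter_filter]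
      refine (congrArg Finset.card (Finset.filter_congr fun w _ => ?_)).trans (hB b hb)
      exact ⟨fun h => h.2, fun h => ⟨h ▸ hb, h⟩⟩
    rw [Finset.sum_congr rfl hsum, Finset.sum_ite, Finset.sum_const, Finset.sum_const, smul_eq_mul,
      smul_eq_mul]
    have hcard' : (W.filter fun w => w ^ r ∉ B).card = W.card - B.card * r := by
      rw [← hcard, ← Finset.card_filter_add_card_filter_not (s := W) (fun w => w ^ r ∈ B)]
      omega
    rw [hcard, hcard']
    rcases B.card with _ | k
    · simp [hitCount]
    · simp [hitCount]

theorem card_mul_le_card {r : ℕ} {W B : Finset ℂ}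
    (hB : ∀ b ∈ B, (W.filter fun w => w ^ r = b).card = r) : B.card * r ≤ W.card := by
  rw [← smul_eq_mul, ← Finset.sum_const, ← Finset.sum_congr rfl hB, ← Finset.card_biUnion]
  · exact Finset.card_le_card (Finset.biUnion_subset.2 fun b _ => Finset.filter_subset _ _)
  · intro b _ c _ hbc
    rw [Function.onFun, Finset.disjoint_left]
    intro w hw hw'
    exact hbc ((Finset.mem_filter.1 hw).2.symm.trans (Finset.mem_filter.1 hw').2)

/-! ### Polynomials of bounded degree -/

/-- The polynomials all of whose monomials have degree less than `d`. -/
def degreeLT (n d : ℕ) : Submodule ℂ (MvPolynomial (Fin n) ℂ) :=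
  restrictSupport ℂ {a | a.degree < d}

theorem mem_degreeLT {n d : ℕ} {f : MvPolynomial (Fin n) ℂ} :
    f ∈ degreeLT n d ↔ ∀ a ∈ f.support, a.degree < d := Iff.rfl

theorem degreeLT_mono {n d e : ℕ} (h : d ≤ e) : degreeLT n d ≤ degreeLT n e :=
  fun _ hf _ ha => (hf ha).trans_le h

theorem _root_.MvPolynomial.IsHomogeneous.mem_degreeLT {n d e : ℕ} {f : MvPolynomial (Fin n) ℂ}
    (hf : f.IsHomogeneous d) (h : d < e) : f ∈ degreeLT n e := fun a ha => by
  have : a.degree = d := by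
    by_contra hne
    exact mem_support_iff.1 ha (hf.coeff_eq_zero hne)
  exact this.trans_lt h

theorem mem_degreeLT_totalDegree_succ {n : ℕ} (f : MvPolynomial (Fin n) ℂ) :
    f ∈ degreeLT n (f.totalDegree + 1) := fun _ ha => Nat.lt_succ_of_le (le_totalDegree ha)

theorem sub_homogeneousComponent_mem {n d : ℕ} {f : MvPolynomial (Fin n) ℂ}
    (hf : f ∈ degreeLT n (d + 1)) : f - homogeneousComponent d f ∈ degreeLT n d := by
  refine mem_degreeLT.2 fun a ha => ?_
  rw [mem_support_iff, coeff_sub, coeff_homogeneousComponent] at ha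
  have h1 : a.degree ≠ d := fun h => by simp [h] at ha
  rw [if_neg h1, sub_zero] at ha
  have h2 : a.degree < d + 1 := hf (mem_support_iff.2 ha)
  exact lt_of_le_of_ne (Nat.le_of_lt_succ h2) h1

theorem homogeneousComponent_of_mem_degreeLT {n d : ℕ} {f : MvPolynomial (Fin n) ℂ}
    (hf : f ∈ degreeLT n d) : homogeneousComponent d f = 0 :=
  homogeneousComponent_eq_zero' d f fun _ ha => (hf ha).ne

theorem monomial_mul_mem_degreeLT {n d : ℕ} {f : MvPolynomial (Fin n) ℂ} (hf : f ∈ degreeLT n d)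
    (a : Fin n →₀ ℕ) (c : ℂ) : monomial a c * f ∈ degreeLT n (a.degree + d) := fun b hb => by
  classical
  obtain ⟨u, hu, v, hv, rfl⟩ := Finset.mem_add.1 (support_mul _ _ hb)
  rw [Finset.mem_singleton.1 (support_monomial_subset hu)]
  have : v.degree < d := hf hv
  rw [Set.mem_ofPred_eq, map_add]
  omega

theorem degreeLT_zero (n : ℕ) : degreeLT n 0 = ⊥ := by
  refine (Submodule.eq_bot_iff _).2 fun f hf => support_eq_empty.1 ?_
  exact Finset.eq_empty_of_forall_notMem fun a ha => absurd (hf ha) (Nat.not_lt_zero _)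

/-- If `I` is generated by homogeneous elements whose degree `e` parts lie in subspaces `V e` that
are compatible with multiplication, then all homogeneous components of elements of `I` lie in the
corresponding subspaces. -/
theorem homogeneousComponent_mem_of_mem_span {n : ℕ}
    (V : ℕ → Submodule ℂ (MvPolynomial (Fin n) ℂ))
    (hV : ∀ e a c, ∀ f ∈ V e, monomial a c * f ∈ V (a.degree + e))
    {T : Set (MvPolynomial (Fin n) ℂ)} (hT : ∀ t ∈ T, ∃ e, t.IsHomogeneous e ∧ t ∈ V e)
    {f : MvPolynomial (Fin n) ℂ} (hf : f ∈ Ideal.span T) (d : ℕ) :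
    homogeneousComponent d f ∈ V d := by
  induction hf using Submodule.closure_induction with
  | zero => simp
  | add f g _ _ hf hg =>
    rw [map_add]
    exact add_mem hf hg
  | smul_mem g t ht =>
    obtain ⟨e, he, hte⟩ := hT t ht
    rw [smul_eq_mul]
    induction g using MvPolynomial.induction_on' with
    | monomial a c =>
      have h := (isHomogeneous_monomial (σ := Fin n) c (rfl : a.degree = a.degree)).mul he
      rw [homogeneousComponent_of_mem h]
      split_ifs with hd
      · exact hd ▸ hV e a c t hte
      · exact zero_mem _
    | add p q hp hq =>
      rw [add_mul, map_add]
      exact add_mem hp hq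

theorem isHomogeneous_esymmPow (r n d : ℕ) : (esymmPow r n d).IsHomogeneous (r * d) := by
  have h : (esymm (Fin n) ℂ d).IsHomogeneous d := by
    refine IsHomogeneous.sum _ _ _ fun s hs => ?_
    have := IsHomogeneous.prod s (fun i => (X i : MvPolynomial (Fin n) ℂ)) (fun _ => 1)
      fun i _ => isHomogeneous_X _ _
    rwa [Finset.sum_const, smul_eq_mul, mul_one, (Finset.mem_powersetCard.1 hs).2] at this
  have h' := h.aeval (fun i => (X i : MvPolynomial (Fin n) ℂ) ^ r)
    fun i => isHomogeneous_X_pow i r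
  rw [esymmPow]
  convert! h' using 1

theorem homogeneousComponent_mem_truncIdeal {r n k m : ℕ} {f : MvPolynomial (Fin n) ℂ}
    (hf : f ∈ truncIdeal r n k m) (d : ℕ) : homogeneousComponent d f ∈ truncIdeal r n k m := by
  refine homogeneousComponent_mem_of_mem_span
    (fun _ => (truncIdeal r n k m).restrictScalars ℂ) (fun _ _ _ f hf => Ideal.mul_mem_left _ _ hf)
    (fun t ht => ?_) hf d
  have ht' : t ∈ truncIdeal r n k m := Ideal.subset_span ht
  rcases ht with ⟨i, rfl⟩ | ⟨d, -, rfl⟩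
  · exact ⟨_, isHomogeneous_X_pow i m, ht'⟩
  · exact ⟨_, isHomogeneous_esymmPow r n d, ht'⟩

/-! ### Top degree components of vanishing polynomials -/

/-- The sum of the vanishing ideal of `Y` and the space of polynomials of degree less than `d`. -/
def vanishingAddLT {n : ℕ} (Y : Set (Fin n → ℂ)) (d : ℕ) : Submodule ℂ (MvPolynomial (Fin n) ℂ) :=
  (vanishingIdeal ℂ Y).restrictScalars ℂ ⊔ degreeLT n d

/-- Together with `mem_topIdeal` this characterizes the homogeneous elements of `T(Y)` of degree
`d`: they are those that agree on `Y` with a polynomial of degree less than `d`. -/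
theorem homogeneousComponent_mem_vanishingAddLT {n : ℕ} {Y : Set (Fin n → ℂ)}
    {f : MvPolynomial (Fin n) ℂ} (hf : f ∈ topIdeal Y) (d : ℕ) :
    homogeneousComponent d f ∈ vanishingAddLT Y d := by
  refine homogeneousComponent_mem_of_mem_span _ (fun e a c f hf => ?_) ?_ hf d
  · obtain ⟨g, hg, h, hh, rfl⟩ := Submodule.mem_sup.1 hf
    rw [mul_add]
    exact Submodule.add_mem_sup (Ideal.mul_mem_left _ _ hg) (monomial_mul_mem_degreeLT hh a c)
  · rintro _ ⟨F, hF, -, rfl⟩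
    refine ⟨_, homogeneousComponent_isHomogeneous _ _, ?_⟩
    have h := sub_homogeneousComponent_mem (mem_degreeLT_totalDegree_succ F)
    rw [← sub_sub_cancel F (homogeneousComponent F.totalDegree F), sub_eq_add_neg]
    exact Submodule.add_mem_sup hF (neg_mem h)

theorem mem_topIdeal {n : ℕ} {Y : Set (Fin n → ℂ)} {d : ℕ} {f : MvPolynomial (Fin n) ℂ}
    (hf : f.IsHomogeneous d) (h : f ∈ vanishingAddLT Y d) : f ∈ topIdeal Y := by
  by_cases h0 : f = 0
  · rw [h0]
    exact zero_mem _
  obtain ⟨F, hF, g, hg, rfl⟩ := Submodule.mem_sup.1 h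
  have hcomp : homogeneousComponent d F = F + g := by
    have := homogeneousComponent_eq_self hf
    rwa [map_add, homogeneousComponent_of_mem_degreeLT hg, add_zero] at this
  have hFd : F ∈ degreeLT n (d + 1) := by
    rw [← add_sub_cancel_right F g]
    exact sub_mem (hf.mem_degreeLT d.lt_succ_self) (degreeLT_mono d.le_succ hg)
  have htot : F.totalDegree = d := by
    refine le_antisymm (Finset.sup_le fun a ha => Nat.le_of_lt_succ (hFd ha)) ?_
    by_contra hlt
    exact h0 (hcomp ▸ homogeneousComponent_eq_zero d F (not_le.1 hlt))
  refine Ideal.subset_span ⟨F, hF, ?_, by rw [htot, hcomp]⟩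
  rintro rfl
  exact h0 (by rw [← hcomp, map_zero])

/-! ### The generators are top degree components -/

/-- The polynomial `∏_{w ∈ W} (x_i - w)` vanishes on `Y` and is monic in `x_i`. -/
theorem X_pow_card_mem_topIdeal {n : ℕ} {Y : Set (Fin n → ℂ)} {W : Finset ℂ} {i : Fin n}
    (hY : ∀ y ∈ Y, y i ∈ W) : (X i : MvPolynomial (Fin n) ℂ) ^ W.card ∈ topIdeal Y := by
  refine mem_topIdeal (isHomogeneous_X_pow i _) ?_
  let q : Polynomial ℂ := ∏ w ∈ W, (Polynomial.X - Polynomial.C w)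
  have hq : q.Monic := Polynomial.monic_prod_of_monic _ _ fun w _ => Polynomial.monic_X_sub_C w
  have hdeg : q.natDegree = W.card := Polynomial.natDegree_finsetProd_X_sub_C_eq_card W fun w => w
  have hsum := congrArg (Polynomial.aeval (X i : MvPolynomial (Fin n) ℂ)) hq.as_sum
  simp only [hdeg, map_add, map_pow, map_sum, map_mul, Polynomial.aeval_X, Polynomial.aeval_C]
    at hsum
  rw [← sub_eq_iff_eq_add] at hsum
  rw [← hsum, sub_eq_add_neg]
  refine Submodule.add_mem_sup ?_ (neg_mem (sum_mem fun j hj => ?_))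
  · rw [Submodule.restrictScalars_mem, mem_vanishingIdeal_iff]
    intro y hy
    rw [← Polynomial.aeval_algHom_apply, aeval_X, Polynomial.coe_aeval_eq_eval, Polynomial.eval_prod]
    refine Finset.prod_eq_zero (hY y hy) ?_
    simp
  · refine IsHomogeneous.mem_degreeLT ?_ (Finset.mem_range.1 hj)
    rw [MvPolynomial.algebraMap_eq]
    exact isHomogeneous_C_mul_X_pow _ i j

theorem prod_C_add_X_pow (r n : ℕ) (c : ℂ) : ∏ i : Fin n, (C c + X i ^ r) =
    ∑ e ∈ Finset.range (n + 1), C (c ^ (n - e)) * esymmPow r n e := by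
  have h := congrArg (Polynomial.eval (C c)) (MvPolynomial.prod_C_add_X_eq_sum_esymm ℂ (Fin n))
  rw [Polynomial.eval_prod, Polynomial.eval_finsetSum] at h
  have h' := congrArg (expand r) h
  simp only [Polynomial.eval_add, Polynomial.eval_X, Polynomial.eval_C, Polynomial.eval_mul,
    Polynomial.eval_pow, map_prod, map_sum, map_add, map_mul, map_pow, expand_X, expand_C,
    Fintype.card_fin] at h'
  rw [h']
  refine Finset.sum_congr rfl fun e _ => ?_
  rw [map_pow, mul_comm]
  rfl

theorem exists_sum_mul_pow_eq {k : ℕ} {c : Fin k → ℂ} (hc : Function.Injective c) (l : Fin k) :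
    ∃ a : Fin k → ℂ, ∀ l' : Fin k, ∑ j, a j * c j ^ (l' : ℕ) = if l = l' then 1 else 0 := by
  refine ⟨(Matrix.vandermonde c)⁻¹ l, fun l' => ?_⟩
  have hdet : IsUnit (Matrix.vandermonde c).det :=
    (Matrix.det_vandermonde_ne_zero_iff.2 hc).isUnit
  have h := congrFun (congrFun (Matrix.nonsing_inv_mul _ hdet) l) l'
  rw [Matrix.mul_apply, Matrix.one_apply] at h
  simpa [Matrix.vandermonde_apply] using h

/-- Each `∏_i (x_i^r - b_j) = ∑_e (-b_j)^(n-e) e_e(x^r)` vanishes on `Y`. As the `b_j` are distinct,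
a combination over `j` isolates `e_d` among the `k` terms with `n - e < k`; the other terms have
lower degree. -/
theorem esymmPow_mem_topIdeal {r n k d : ℕ} (hr : 0 < r) {Y : Set (Fin n → ℂ)} {b : Fin k → ℂ}
    (hb : Function.Injective b) (hY : ∀ y ∈ Y, ∀ j, ∃ i, y i ^ r = b j) (hd : n < d + k) :
    esymmPow r n d ∈ topIdeal Y := by
  rcases Nat.lt_or_ge n d with hnd | hdn
  · rw [esymmPow_eq_zero hnd]
    exact zero_mem _
  refine mem_topIdeal (isHomogeneous_esymmPow r n d) ?_
  obtain ⟨a, ha⟩ := exists_sum_mul_pow_eq (c := fun j => -b j) (fun i j h => hb (neg_injective h))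
    ⟨n - d, by omega⟩
  have hsum : ∑ j, C (a j) * ∏ i : Fin n, (C (-b j) + X i ^ r) =
      ∑ e ∈ Finset.range (n + 1), C (∑ j, a j * (-b j) ^ (n - e)) * esymmPow r n e := by
    simp only [prod_C_add_X_pow, Finset.mul_sum, map_sum, Finset.sum_mul, map_mul, mul_assoc]
    exact Finset.sum_comm
  have hone : ∑ j, a j * (-b j) ^ (n - d) = 1 := by
    have := ha ⟨n - d, by omega⟩
    simpa using this
  rw [← Finset.add_sum_erase _ _ (Finset.mem_range.2 (Nat.lt_succ_of_le hdn)), hone, C_1, one_mul,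
    ← sub_eq_iff_eq_add] at hsum
  rw [← hsum, sub_eq_add_neg]
  refine Submodule.add_mem_sup ?_ (neg_mem (sum_mem fun e he => ?_))
  · rw [Submodule.restrictScalars_mem, mem_vanishingIdeal_iff]
    intro y hy
    rw [map_sum]
    refine Finset.sum_eq_zero fun j _ => ?_
    obtain ⟨i, hi⟩ := hY y hy j
    rw [map_mul, map_prod, Finset.prod_eq_zero (Finset.mem_univ i) (by simp [hi]), mul_zero]
  · rw [Finset.mem_erase, Finset.mem_range] at he
    rcases Nat.lt_or_ge (n - e) k with h | h
    · have := ha ⟨n - e, h⟩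
      rw [if_neg (by rw [Fin.mk.injEq]; omega)] at this
      dsimp only at this
      rw [this, C_0, zero_mul]
      exact zero_mem _
    · exact ((isHomogeneous_esymmPow r n e).C_mul _).mem_degreeLT
        (Nat.mul_lt_mul_of_pos_left (by omega) hr)

theorem truncIdeal_le_topIdeal {r n k : ℕ} (hr : 0 < r) {Y : Set (Fin n → ℂ)} {W : Finset ℂ}
    {b : Fin k → ℂ} (hb : Function.Injective b) (hW : ∀ y ∈ Y, ∀ i, y i ∈ W)
    (hY : ∀ y ∈ Y, ∀ j, ∃ i, y i ^ r = b j) : truncIdeal r n k W.card ≤ topIdeal Y := by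
  refine Ideal.span_le.2 (Set.union_subset ?_ ?_)
  · rintro _ ⟨i, rfl⟩
    exact X_pow_card_mem_topIdeal fun y hy => hW y hy i
  · rintro _ ⟨d, hd, rfl⟩
    exact esymmPow_mem_topIdeal hr hb hY hd

/-! ### Graded and equivariant projections along an ideal -/

/-- Any linear section of the quotient map gives a projection `q` along `I`. Keeping on each
monomial only the component of `q` in the degree of that monomial makes it graded, and homogeneity
of `I` preserves the other properties. -/
theorem exists_graded_projection {n : ℕ} {I : Ideal (MvPolynomial (Fin n) ℂ)}
    (hI : ∀ f ∈ I, ∀ d, homogeneousComponent d f ∈ I) :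
    ∃ p : MvPolynomial (Fin n) ℂ →ₗ[ℂ] MvPolynomial (Fin n) ℂ,
      (∀ f ∈ I, p f = 0) ∧ (∀ f, f - p f ∈ I) ∧
      ∀ d f, f.IsHomogeneous d → (p f).IsHomogeneous d := by
  obtain ⟨s, hs⟩ := (I.restrictScalars ℂ).mkQ.exists_rightInverse_of_surjective
    (LinearMap.range_eq_top.2 (Submodule.mkQ_surjective _))
  let q := s ∘ₗ (I.restrictScalars ℂ).mkQ
  have hq0 : ∀ f ∈ I, q f = 0 := fun f hf => by
    have : (I.restrictScalars ℂ).mkQ f = 0 := (Submodule.Quotient.mk_eq_zero _).2 hf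
    simp only [q, LinearMap.comp_apply, this, map_zero]
  have hq : ∀ f, f - q f ∈ I := fun f => by
    refine (Submodule.Quotient.mk_eq_zero (I.restrictScalars ℂ)).1 ?_
    have := DFunLike.congr_fun hs ((I.restrictScalars ℂ).mkQ f)
    rw [LinearMap.comp_apply, LinearMap.id_apply] at this
    rw [← Submodule.mkQ_apply, map_sub, LinearMap.comp_apply, this, sub_self]
  let p := (basisMonomials (Fin n) ℂ).constr ℂ
    fun a => homogeneousComponent a.degree (q (monomial a 1))
  have hp : ∀ d f, f.IsHomogeneous d → p f = homogeneousComponent d (q f) := fun d f hf => by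
    rw [f.as_sum]
    simp only [map_sum]
    refine Finset.sum_congr rfl fun a ha => ?_
    have hd : a.degree = d := by
      by_contra hne
      exact mem_support_iff.1 ha (hf.coeff_eq_zero hne)
    have hm : monomial a (coeff a f) = coeff a f • monomial a (1 : ℂ) := by
      rw [smul_monomial, smul_eq_mul, mul_one]
    rw [hm]
    simp only [map_smul]
    congr 1
    have := (basisMonomials (Fin n) ℂ).constr_basis ℂ
      (fun a => homogeneousComponent a.degree (q (monomial a 1))) a
    rw [coe_basisMonomials] at this
    rw [← hd]
    exact this
  have hcomp : ∀ d f, p (homogeneousComponent d f) =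
      homogeneousComponent d (q (homogeneousComponent d f)) := fun d f =>
    hp d _ (homogeneousComponent_isHomogeneous d f)
  refine ⟨p, fun f hf => ?_, fun f => ?_, fun d f hf => ?_⟩
  · rw [← sum_homogeneousComponent f, map_sum]
    refine Finset.sum_eq_zero fun d _ => ?_
    rw [hcomp, hq0 _ (hI f hf d), map_zero]
  · rw [← sum_homogeneousComponent f, map_sum, ← Finset.sum_sub_distrib]
    refine sum_mem fun d _ => ?_
    have := hI _ (hq (homogeneousComponent d f)) d
    rwa [map_sub, homogeneousComponent_eq_self (homogeneousComponent_isHomogeneous d f),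
      ← hcomp] at this
  · rw [hp d f hf]
    exact homogeneousComponent_isHomogeneous _ _

instance (r n : ℕ) [NeZero r] : Finite (Gn r n) := by
  have key : ∀ (g : Gn r n) i j,
      g.1 i j ∈ insert (0 : ℂ) (Set.range fun c : Fin r => zeta r ^ (c : ℕ)) := fun g i j => by
    obtain ⟨s, c, h⟩ := Gn_form g
    rw [h]
    split_ifs
    · obtain ⟨d, hd⟩ := exists_color (c j) (0 : Fin r)
      exact Or.inr ⟨d, by simpa using hd.symm⟩
    · exact Or.inl rfl
  have : Finite ↥(insert (0 : ℂ) (Set.range fun c : Fin r => zeta r ^ (c : ℕ))) :=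
    ((Set.finite_range _).insert _).to_subtype
  refine Finite.of_injective (fun (g : Gn r n) (i j : Fin n) =>
    (⟨g.1 i j, key g i j⟩ : ↥(insert (0 : ℂ) (Set.range fun c : Fin r => zeta r ^ (c : ℕ))))) ?_
  intro g h hgh
  refine Subtype.ext (Units.ext (Matrix.ext fun i j => ?_))
  exact congrArg Subtype.val (congrFun (congrFun hgh i) j)

theorem isHomogeneous_polyAct {n d : ℕ} (g : GL (Fin n) ℂ) {f : MvPolynomial (Fin n) ℂ}
    (hf : f.IsHomogeneous d) : (polyAct g f).IsHomogeneous d := by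
  rw [← one_mul d]
  exact hf.aeval _ fun i => IsHomogeneous.sum _ _ _ fun j _ => isHomogeneous_C_mul_X _ _

/-- Maschke averaging of a graded projection; the action preserves degrees and `I` is stable, so
nothing is lost. -/
theorem exists_equivariant_projection {r n : ℕ} [NeZero r] {I : Ideal (MvPolynomial (Fin n) ℂ)}
    (hI : ∀ f ∈ I, ∀ d, homogeneousComponent d f ∈ I) (hst : IsStable r I) :
    ∃ p : MvPolynomial (Fin n) ℂ →ₗ[ℂ] MvPolynomial (Fin n) ℂ,
      (∀ f ∈ I, p f = 0) ∧ (∀ f, f - p f ∈ I) ∧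
      (∀ d f, f.IsHomogeneous d → (p f).IsHomogeneous d) ∧
      ∀ (g : Gn r n) f, p (polyAct g.1 f) = polyAct g.1 (p f) := by
  obtain ⟨q, hq0, hq, hqd⟩ := exists_graded_projection hI
  have := Fintype.ofFinite (Gn r n)
  let p : MvPolynomial (Fin n) ℂ →ₗ[ℂ] MvPolynomial (Fin n) ℂ := (Fintype.card (Gn r n) : ℂ)⁻¹ •
    ∑ g : Gn r n, (polyAct g.1).toLinearMap ∘ₗ q ∘ₗ (polyAct (g⁻¹ : Gn r n).1).toLinearMap
  have hp : ∀ f, p f = (Fintype.card (Gn r n) : ℂ)⁻¹ •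
      ∑ g : Gn r n, polyAct g.1 (q (polyAct (g⁻¹ : Gn r n).1 f)) := fun f => by
    simp [p, LinearMap.sum_apply]
  have hact : ∀ (g h : Gn r n) f, polyAct (g * h : Gn r n).1 f = polyAct g.1 (polyAct h.1 f) :=
    fun g h f => DFunLike.congr_fun (polyAct_mul g.1 h.1) f
  have hcard : (Fintype.card (Gn r n) : ℂ) ≠ 0 := Nat.cast_ne_zero.2 Fintype.card_ne_zero
  refine ⟨p, fun f hf => ?_, fun f => ?_, fun d f hf => ?_, fun g f => ?_⟩
  · rw [hp, Finset.sum_eq_zero, smul_zero]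
    intro g _
    rw [hq0 _ (hst g⁻¹ hf), map_zero]
  -- With `f` written as an average too, `f - p f` becomes the average of `g (g⁻¹ f - q (g⁻¹ f))`,
  -- each term of which lies in `I`.
  · have hf : f = (Fintype.card (Gn r n) : ℂ)⁻¹ •
        ∑ g : Gn r n, polyAct g.1 (polyAct (g⁻¹ : Gn r n).1 f) := by
      rw [Finset.sum_congr rfl (g := fun _ => f) fun g _ => by
        rw [← hact, mul_inv_cancel]
        exact DFunLike.congr_fun polyAct_one f]
      rw [Finset.sum_const, Finset.card_univ, ← Nat.cast_smul_eq_nsmul ℂ, smul_smul,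
        inv_mul_cancel₀ hcard, one_smul]
    nth_rw 1 [hf]
    rw [hp, ← smul_sub, ← Finset.sum_sub_distrib, smul_eq_C_mul]
    refine Ideal.mul_mem_left _ _ (sum_mem fun g _ => ?_)
    rw [← map_sub]
    exact hst g (hq _)
  · rw [hp, smul_eq_C_mul]
    refine IsHomogeneous.C_mul (IsHomogeneous.sum _ _ _ fun g _ => ?_) _
    exact isHomogeneous_polyAct _ (hqd _ _ (isHomogeneous_polyAct _ hf))
  · rw [hp, hp, map_smul, map_sum]
    refine congrArg _ (Fintype.sum_equiv (Equiv.mulLeft g) _ _ fun h => ?_).symm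
    rw [Equiv.coe_mulLeft, hact, mul_inv_rev, ← hact (h⁻¹ * g⁻¹) g, inv_mul_cancel_right]

/-! ### Comparison of the quotient ring with the functions on a point set -/

/-- Evaluation of polynomials at a family of points. -/
def evalAt {n : ℕ} {X : Type*} (y : X → Fin n → ℂ) : MvPolynomial (Fin n) ℂ →ₗ[ℂ] X → ℂ :=
  LinearMap.pi fun x => (aeval (y x)).toLinearMap

theorem evalAt_apply {n : ℕ} {X : Type*} (y : X → Fin n → ℂ) (f : MvPolynomial (Fin n) ℂ) (x : X) :
    evalAt y f x = aeval (y x) f := rfl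

theorem evalAt_eq_zero_iff {n : ℕ} {X : Type*} {y : X → Fin n → ℂ} {f : MvPolynomial (Fin n) ℂ} :
    evalAt y f = 0 ↔ f ∈ vanishingIdeal ℂ (Set.range y) := by
  rw [mem_vanishingIdeal_iff, Set.forall_mem_range, funext_iff]
  rfl

theorem evalAt_surjective {n : ℕ} {X : Type*} [Finite X] {y : X → Fin n → ℂ}
    (hy : Function.Injective y) : Function.Surjective (evalAt y) := by
  classical
  have := Fintype.ofFinite X
  -- Lagrange interpolation: the factors are affine functions of a coordinate in which the two
  -- points differ.
  have hsep : ∀ x x', ∃ f : MvPolynomial (Fin n) ℂ, x ≠ x' → aeval (y x) f = 1 ∧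
      aeval (y x') f = 0 := fun x x' => by
    by_cases h : x = x'
    · exact ⟨0, fun h' => absurd h h'⟩
    · obtain ⟨i, hi⟩ := Function.ne_iff.1 (hy.ne h)
      refine ⟨C (y x i - y x' i)⁻¹ * (MvPolynomial.X i - C (y x' i)), fun _ => ⟨?_, by simp⟩⟩
      simp [inv_mul_cancel₀ (sub_ne_zero.2 hi)]
  choose f hf using hsep
  intro v
  refine ⟨∑ x, C (v x) * ∏ x' ∈ Finset.univ.erase x, f x x', funext fun z => ?_⟩
  rw [evalAt_apply, map_sum, Finset.sum_eq_single z]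
  · rw [map_mul, map_prod, Finset.prod_eq_one, mul_one, algHom_C]
    · rfl
    · exact fun x' hx' => (hf z x' (Finset.ne_of_mem_erase hx').symm).1
  · intro x _ hx
    rw [map_mul, map_prod, Finset.prod_eq_zero (Finset.mem_erase.2 ⟨hx.symm, Finset.mem_univ z⟩)
      (hf x z hx).2, mul_zero]
  · simp

section

variable {n : ℕ} {X : Type*} {y : X → Fin n → ℂ} {I : Ideal (MvPolynomial (Fin n) ℂ)}
  {p : MvPolynomial (Fin n) ℂ →ₗ[ℂ] MvPolynomial (Fin n) ℂ}

theorem exists_evalAt_eq_of_isHomogeneous (hIT : I ≤ topIdeal (Set.range y)) {d : ℕ}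
    {f : MvPolynomial (Fin n) ℂ} (hf : f ∈ I) (hd : f.IsHomogeneous d) :
    ∃ f₁ ∈ degreeLT n d, evalAt y f = evalAt y f₁ := by
  have h := homogeneousComponent_mem_vanishingAddLT (hIT hf) d
  rw [homogeneousComponent_eq_self hd] at h
  obtain ⟨F, hF, g, hg, rfl⟩ := Submodule.mem_sup.1 h
  refine ⟨g, hg, ?_⟩
  rw [map_add, evalAt_eq_zero_iff.2 hF, zero_add]

/-- Let `g` be the degree `d` part of `f`. Then `g - p g ∈ I` agrees on `Y` with some `f₁` of lower
degree, so on `Y` one has `f = p g + (f₁ + (f - g))`, and induction applies to the bracket. -/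
theorem exists_evalAt_eq_evalAt_projection (hIT : I ≤ topIdeal (Set.range y))
    (hp : ∀ f, f - p f ∈ I) (hpd : ∀ d f, f.IsHomogeneous d → (p f).IsHomogeneous d) {d : ℕ}
    {f : MvPolynomial (Fin n) ℂ} (hf : f ∈ degreeLT n d) :
    ∃ f' ∈ degreeLT n d, evalAt y f = evalAt y (p f') := by
  induction d generalizing f with
  | zero =>
    rw [degreeLT_zero, Submodule.mem_bot] at hf
    exact ⟨0, zero_mem _, by simp [hf]⟩
  | succ d ih =>
    have hg := homogeneousComponent_isHomogeneous d f
    have hlt := sub_homogeneousComponent_mem hf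
    set g := homogeneousComponent d f
    obtain ⟨f₁, hf₁, h₁⟩ := exists_evalAt_eq_of_isHomogeneous hIT (hp g) (hg.sub (hpd d g hg))
    obtain ⟨f₂, hf₂, h₂⟩ := ih (add_mem hf₁ hlt)
    refine ⟨g + f₂, add_mem (hg.mem_degreeLT d.lt_succ_self) (degreeLT_mono d.le_succ hf₂), ?_⟩
    rw [map_add, map_add, ← h₂, map_add, ← h₁, ← map_add, ← map_add]
    congr 1
    ring

theorem evalAt_projection_surjective [Finite X] (hy : Function.Injective y)
    (hIT : I ≤ topIdeal (Set.range y)) (hp : ∀ f, f - p f ∈ I)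
    (hpd : ∀ d f, f.IsHomogeneous d → (p f).IsHomogeneous d) :
    Function.Surjective (evalAt y ∘ₗ p) := fun v => by
  obtain ⟨f, rfl⟩ := evalAt_surjective hy v
  obtain ⟨f', -, h⟩ := exists_evalAt_eq_evalAt_projection hIT hp hpd
    (mem_degreeLT_totalDegree_succ f)
  exact ⟨f', h.symm⟩

/-- The span `V` of at most `|X|` polynomials already maps onto `X → ℂ`, so the map is injective on
`V`; since `V` and `I` together give everything, the kernel is no larger than `I`. -/
theorem mem_of_evalAt_projection_eq_zero [Finite X] (hI : SpannedBy I (Nat.card X))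
    (hp0 : ∀ f ∈ I, p f = 0) (hsurj : Function.Surjective (evalAt y ∘ₗ p))
    {f : MvPolynomial (Fin n) ℂ} (hf : evalAt y (p f) = 0) : f ∈ I := by
  have := Fintype.ofFinite X
  obtain ⟨S, hS, hspan⟩ := hI
  set V := Submodule.span ℂ (S : Set (MvPolynomial (Fin n) ℂ))
  have hfin : FiniteDimensional ℂ V := FiniteDimensional.span_finset ℂ S
  have hdecomp : ∀ f, ∃ v ∈ V, ∃ i ∈ I, v + i = f := fun f =>
    Submodule.mem_sup.1 (hspan ▸ Submodule.mem_top : f ∈ V ⊔ I.restrictScalars ℂ)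
  let φ := (evalAt y ∘ₗ p) ∘ₗ V.subtype
  have hφ : Function.Surjective φ := fun w => by
    obtain ⟨f, rfl⟩ := hsurj w
    obtain ⟨v, hv, i, hi, rfl⟩ := hdecomp f
    exact ⟨⟨v, hv⟩, by simp [φ, hp0 i hi]⟩
  have hle : Module.finrank ℂ V ≤ Module.finrank ℂ (X → ℂ) := by
    rw [Module.finrank_fintype_fun_eq_card, ← Nat.card_eq_fintype_card]
    exact (finrank_span_finset_le_card S).trans hS
  have hge := LinearMap.finrank_le_finrank_of_surjective hφ
  have hinj := (LinearMap.injective_iff_surjective_of_finrank_eq_finrank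
    (le_antisymm hle hge)).2 hφ
  obtain ⟨v, hv, i, hi, rfl⟩ := hdecomp f
  have hv0 : (⟨v, hv⟩ : V) = 0 := hinj (by simpa [φ, hp0 i hi] using hf)
  rw [show v = 0 from congrArg Subtype.val hv0, zero_add]
  exact hi

/-- If `F` vanishes on `Y` and has top component `h`, then on `Y` it equals `p (h + f₂)` with `f₂`
of lower degree. Hence `h + f₂ ∈ I`, and homogeneity of `I` extracts `h`. -/
theorem topIdeal_le (hI : ∀ f ∈ I, ∀ d, homogeneousComponent d f ∈ I)
    (hIT : I ≤ topIdeal (Set.range y)) (hp : ∀ f, f - p f ∈ I)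
    (hpd : ∀ d f, f.IsHomogeneous d → (p f).IsHomogeneous d)
    (hinj : ∀ f, evalAt y (p f) = 0 → f ∈ I) : topIdeal (Set.range y) ≤ I := by
  refine Ideal.span_le.2 ?_
  rintro _ ⟨F, hF, -, rfl⟩
  have hh := homogeneousComponent_isHomogeneous F.totalDegree F
  have hlt := sub_homogeneousComponent_mem (mem_degreeLT_totalDegree_succ F)
  set d := F.totalDegree
  set h := homogeneousComponent d F
  obtain ⟨f₁, hf₁, h₁⟩ := exists_evalAt_eq_of_isHomogeneous hIT (hp h) (hh.sub (hpd d h hh))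
  obtain ⟨f₂, hf₂, h₂⟩ := exists_evalAt_eq_evalAt_projection hIT hp hpd (add_mem hf₁ hlt)
  have hmem : h + f₂ ∈ I := hinj _ (by
    rw [map_add, map_add, ← h₂, map_add, ← h₁, ← map_add, ← map_add,
      ← evalAt_eq_zero_iff.2 hF]
    congr 1
    ring)
  have := hI _ hmem d
  rwa [map_add, homogeneousComponent_eq_self hh, homogeneousComponent_of_mem_degreeLT hf₂,
    add_zero] at this

end

theorem topIdeal_eq {r n : ℕ} [NeZero r] {X : Type*} [Finite X] {y : X → Fin n → ℂ}
    (hy : Function.Injective y) {I : Ideal (MvPolynomial (Fin n) ℂ)}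
    (hI : ∀ f ∈ I, ∀ d, homogeneousComponent d f ∈ I)
    (hIT : I ≤ topIdeal (Set.range y)) (hspan : SpannedBy I (Nat.card X)) :
    I = topIdeal (Set.range y) := by
  obtain ⟨p, hp0, hp, hpd⟩ := exists_graded_projection hI
  exact le_antisymm hIT (topIdeal_le hI hIT hp hpd fun f =>
    mem_of_evalAt_projection_eq_zero hspan hp0 (evalAt_projection_surjective hy hIT hp hpd))

theorem aeval_polyAct {n : ℕ} (g : GL (Fin n) ℂ) (f : MvPolynomial (Fin n) ℂ) (v : Fin n → ℂ) :
    aeval v (polyAct g f) = aeval ((g⁻¹ : GL (Fin n) ℂ).1.mulVec v) f := by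
  have : (aeval v).comp (polyAct g) = aeval ((g⁻¹ : GL (Fin n) ℂ).1.mulVec v) := by
    apply MvPolynomial.algHom_ext
    intro i
    simp [polyAct, Matrix.mulVec, dotProduct]
  exact DFunLike.congr_fun this f

theorem nonempty_quotientRep_equiv {r n : ℕ} [NeZero r] {X : Type*} [Finite X]
    [MulAction (Gn r n) X] {y : X → Fin n → ℂ} (hy : Function.Injective y)
    (hequiv : ∀ (g : Gn r n) x, y (g • x) = g.1.1.mulVec (y x))
    {I : Ideal (MvPolynomial (Fin n) ℂ)} (hI : ∀ f ∈ I, ∀ d, homogeneousComponent d f ∈ I)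
    (hst : IsStable r I) (hIT : I ≤ topIdeal (Set.range y)) (hspan : SpannedBy I (Nat.card X)) :
    Nonempty ((quotientRep I hst).Equiv (Representation.ofMulAction ℂ (Gn r n) X)) := by
  obtain ⟨p, hp0, hp, hpd, hpg⟩ := exists_equivariant_projection hI hst
  have hsurj := evalAt_projection_surjective hy hIT hp hpd
  let e : (X → ℂ) ≃ₗ[ℂ] MonoidAlgebra ℂ X :=
    (Finsupp.linearEquivFunOnFinite ℂ ℂ X).symm.trans (MonoidAlgebra.coeffLinearEquiv ℂ).symm
  have he : ∀ v x, (e v).coeff x = v x := fun v x => rfl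
  let φ : MvPolynomial (Fin n) ℂ →ₗ[ℂ] (X → ℂ) := evalAt y ∘ₗ p
  have hφ : I.restrictScalars ℂ ≤ LinearMap.ker φ := fun f hf => by
    simp [φ, hp0 f hf]
  let ψ : (MvPolynomial (Fin n) ℂ ⧸ I) →ₗ[ℂ] (X → ℂ) :=
    (I.restrictScalars ℂ).liftQ φ hφ ∘ₗ
      (Submodule.Quotient.restrictScalarsEquiv ℂ I).symm.toLinearMap
  have hψ : ∀ f, ψ (Ideal.Quotient.mk I f) = φ f := fun f => rfl
  have hbij : Function.Bijective ψ := by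
    refine ⟨(injective_iff_map_eq_zero ψ).2 fun q hq => ?_, fun v => ?_⟩
    · obtain ⟨f, rfl⟩ := Ideal.Quotient.mk_surjective q
      exact Ideal.Quotient.eq_zero_iff_mem.2
        (mem_of_evalAt_projection_eq_zero hspan hp0 hsurj hq)
    · obtain ⟨f, rfl⟩ := hsurj v
      exact ⟨Ideal.Quotient.mk I f, rfl⟩
  refine ⟨Representation.Equiv.mk ((LinearEquiv.ofBijective ψ hbij).trans e) fun g => ?_⟩
  refine LinearMap.ext fun q => ?_
  obtain ⟨f, rfl⟩ := Ideal.Quotient.mk_surjective q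
  ext x
  rw [LinearMap.comp_apply, LinearMap.comp_apply, Representation.coeff_ofMulAction]
  -- The group acts on coefficient functions by `v ↦ v (g⁻¹ • ·)`, which matches `(g · f)(v) = f(g⁻¹
  -- v)` at the points `y x`.
  change evalAt y (p (polyAct g.1 f)) x = evalAt y (p f) (g⁻¹ • x)
  rw [hpg, evalAt_apply, evalAt_apply, aeval_polyAct, hequiv]
  rfl

/-! ### Faces as points -/

theorem norm_zeta (r : ℕ) [NeZero r] : ‖zeta r‖ = 1 :=
  (zeta_primitive r).norm'_eq_one (NeZero.ne r)

theorem norm_zeta_pow_mul {r : ℕ} [NeZero r] (c : ℕ) {a : ℝ} (ha : 0 < a) :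
    ‖zeta r ^ c * (a : ℂ)‖ = a := by
  rw [norm_mul, norm_pow, norm_zeta, one_pow, one_mul, Complex.norm_of_nonneg ha.le]

theorem zeta_pow_mul_ne_zero (r c : ℕ) {a : ℝ} (ha : 0 < a) : zeta r ^ c * (a : ℂ) ≠ 0 :=
  mul_ne_zero (pow_ne_zero _ (zeta_ne_zero r)) (Complex.ofReal_ne_zero.2 ha.ne')

open Classical in
/-- The point whose `i`-th coordinate is `ζ^c α_j` if `i` has color `c` and lies in the `j`-th
block, and `0` if `i` lies in the zero block. -/
def facePoint {r n k : ℕ} (α : Fin k → ℝ) (σ : Face r n k) (i : Fin n) : ℂ :=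
  if h : ∃ p : Fin k × Fin r, (i, p.2) ∈ σ.block p.1 then
    zeta r ^ (h.choose.2 : ℕ) * (α h.choose.1 : ℂ) else 0

section

variable {r n k : ℕ} {α : Fin k → ℝ}

theorem Face.mem_block_unique (σ : Face r n k) {i : Fin n} {p q : Fin k × Fin r}
    (hp : (i, p.2) ∈ σ.block p.1) (hq : (i, q.2) ∈ σ.block q.1) : p = q := by
  rcases σ.partition i with ⟨-, h⟩ | ⟨-, h⟩
  · exact absurd hp (h _ _)
  · exact h.unique hp hq

theorem Face.mem_zeroBlock_or (σ : Face r n k) (i : Fin n) :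
    i ∈ σ.zeroBlock ∨ ∃ j c, (i, c) ∈ σ.block j := by
  rcases σ.partition i with ⟨h, -⟩ | ⟨-, p, h, -⟩
  · exact Or.inl h
  · exact Or.inr ⟨p.1, p.2, h⟩

theorem facePoint_of_mem_block {σ : Face r n k} {i : Fin n} {j : Fin k} {c : Fin r}
    (h : (i, c) ∈ σ.block j) : facePoint α σ i = zeta r ^ (c : ℕ) * (α j : ℂ) := by
  have hex : ∃ p : Fin k × Fin r, (i, p.2) ∈ σ.block p.1 := ⟨(j, c), h⟩
  rw [facePoint, dif_pos hex, σ.mem_block_unique hex.choose_spec (q := (j, c)) h]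

theorem facePoint_of_mem_zeroBlock {σ : Face r n k} {i : Fin n} (h : i ∈ σ.zeroBlock) :
    facePoint α σ i = 0 := by
  rw [facePoint, dif_neg]
  rintro ⟨p, hp⟩
  rcases σ.partition i with ⟨-, h'⟩ | ⟨h', -⟩
  · exact h' _ _ hp
  · exact h' h

theorem facePoint_eq_zero_iff (hα : ∀ j, 0 < α j) {σ : Face r n k} {i : Fin n} :
    facePoint α σ i = 0 ↔ i ∈ σ.zeroBlock := by
  refine ⟨fun h => (σ.mem_zeroBlock_or i).resolve_right ?_, facePoint_of_mem_zeroBlock⟩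
  rintro ⟨j, c, hc⟩
  rw [facePoint_of_mem_block hc] at h
  exact zeta_pow_mul_ne_zero r c (hα j) h

theorem zeta_pow_mul_inj [NeZero r] (hα : ∀ j, 0 < α j) (hinj : Function.Injective α)
    {c d : Fin r} {j l : Fin k}
    (h : zeta r ^ (c : ℕ) * (α j : ℂ) = zeta r ^ (d : ℕ) * (α l : ℂ)) : c = d ∧ j = l := by
  have hjl : j = l := hinj (by
    rw [← norm_zeta_pow_mul (r := r) c (hα j), h, norm_zeta_pow_mul d (hα l)])
  subst hjl
  exact ⟨zeta_pow_inj (mul_right_cancel₀ (Complex.ofReal_ne_zero.2 (hα j).ne') h), rfl⟩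

theorem facePoint_eq_iff [NeZero r] (hα : ∀ j, 0 < α j) (hinj : Function.Injective α)
    {σ : Face r n k} {i : Fin n} {j : Fin k} {c : Fin r} :
    facePoint α σ i = zeta r ^ (c : ℕ) * (α j : ℂ) ↔ (i, c) ∈ σ.block j := by
  refine ⟨fun h => ?_, facePoint_of_mem_block⟩
  rcases σ.mem_zeroBlock_or i with hi | ⟨l, d, hd⟩
  · rw [facePoint_of_mem_zeroBlock hi] at h
    exact absurd h.symm (zeta_pow_mul_ne_zero r c (hα j))
  · rw [facePoint_of_mem_block hd] at h
    obtain ⟨rfl, rfl⟩ := zeta_pow_mul_inj hα hinj h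
    exact hd

theorem facePoint_injective [NeZero r] (hα : ∀ j, 0 < α j) (hinj : Function.Injective α) :
    Function.Injective (facePoint α : Face r n k → Fin n → ℂ) := fun σ τ h => by
  ext1
  · ext i
    rw [← facePoint_eq_zero_iff hα, h, facePoint_eq_zero_iff hα]
  · ext j ⟨i, c⟩
    rw [← facePoint_eq_iff hα hinj, h, facePoint_eq_iff hα hinj]

theorem range_facePoint [NeZero r] (hα : ∀ j, 0 < α j) (hinj : Function.Injective α) :
    Set.range (facePoint α : Face r n k → Fin n → ℂ) = pointsY r n k α := by
  ext y
  constructor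
  · rintro ⟨σ, rfl⟩
    refine ⟨fun i => ?_, ?_⟩
    · rcases σ.mem_zeroBlock_or i with hi | ⟨j, c, hc⟩
      · exact Or.inl (facePoint_of_mem_zeroBlock hi)
      · exact Or.inr ⟨c, j, facePoint_of_mem_block hc⟩
    · rintro _ ⟨j, rfl⟩
      obtain ⟨⟨i, c⟩, h⟩ := σ.nonempty j
      exact ⟨i, by simp only [facePoint_of_mem_block h, norm_zeta_pow_mul c (hα j)]⟩
  · rintro ⟨hy, hy'⟩
    -- The blocks are the level sets of the coordinates; they are nonempty because every `α_j`
    -- occurs as a norm and the `α_j` are distinct.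
    let σ : Face r n k :=
      { zeroBlock := {i | y i = 0}
        block := fun j => {p | y p.1 = zeta r ^ (p.2 : ℕ) * (α j : ℂ)}
        nonempty := fun j => by
          obtain ⟨i, hi⟩ := hy' ⟨j, rfl⟩
          rcases hy i with h | ⟨c, l, h⟩
          · simp only [h, norm_zero] at hi
            exact absurd hi (hα j).ne
          · simp only [h, norm_zeta_pow_mul c (hα l)] at hi
            exact ⟨(i, c), hinj hi ▸ h⟩
        partition := fun i => by
          rcases hy i with h | ⟨c, l, h⟩
          · exact Or.inl ⟨h, fun j c h' => zeta_pow_mul_ne_zero r c (hα j) (h'.symm.trans h)⟩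
          · refine Or.inr ⟨fun h' => zeta_pow_mul_ne_zero r c (hα l) (h.symm.trans h'),
              (l, c), h, fun p hp => ?_⟩
            obtain ⟨h₁, h₂⟩ := zeta_pow_mul_inj hα hinj (hp.symm.trans h)
            exact Prod.ext h₂ h₁ }
    refine ⟨σ, funext fun i => ?_⟩
    rcases hy i with h | ⟨c, j, h⟩
    · rw [h]
      exact facePoint_of_mem_zeroBlock h
    · rw [h]
      exact facePoint_of_mem_block h

theorem facePoint_smul [NeZero r] (g : Gn r n) (σ : Face r n k) :
    facePoint α (g • σ) = g.1.1.mulVec (facePoint α σ) := by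
  obtain ⟨s, m, h⟩ := Gn_form g
  have hz : ∀ i, zeta r ^ m i ≠ 0 := fun i => zpow_ne_zero _ (zeta_ne_zero r)
  funext i'
  obtain ⟨i, rfl⟩ := s.surjective i'
  have hmul : g.1.1.mulVec (facePoint α σ) (s i) = zeta r ^ m i * facePoint α σ i := by
    rw [Matrix.mulVec, dotProduct, Finset.sum_eq_single i]
    · rw [h, if_pos rfl]
    · intro l _ hl
      rw [h, if_neg (fun e => hl (s.injective e).symm), zero_mul]
    · simp
  rw [hmul]
  rcases σ.mem_zeroBlock_or i with hi | ⟨j, c, hc⟩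
  · rw [facePoint_of_mem_zeroBlock hi, mul_zero]
    refine facePoint_of_mem_zeroBlock (σ := g • σ) ⟨i, hi, ?_⟩
    rw [h, if_pos rfl]
    exact hz i
  · obtain ⟨d, hd⟩ := exists_color (m i) c
    rw [facePoint_of_mem_block hc, ← mul_assoc, hd]
    refine facePoint_of_mem_block (σ := g • σ) ⟨(i, c), hc, ?_⟩
    dsimp only
    rw [h, if_pos rfl, hd]

theorem range_facePoint_OP [NeZero r] (hα : ∀ j, 0 < α j) (hinj : Function.Injective α) :
    Set.range (fun σ : OP r n k => facePoint α σ.1) = pointsZ r n k α := by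
  ext y
  constructor
  · rintro ⟨σ, rfl⟩
    refine ⟨(range_facePoint hα hinj).subset ⟨σ.1, rfl⟩, fun i hi => ?_⟩
    have hσ : σ.1.zeroBlock = ∅ := σ.2
    have := (facePoint_eq_zero_iff hα).1 hi
    rw [hσ] at this
    exact this
  · rintro ⟨hy, hy0⟩
    rw [← range_facePoint hα hinj] at hy
    obtain ⟨σ, rfl⟩ := hy
    exact ⟨⟨σ, Set.eq_empty_of_forall_notMem fun i hi =>
      hy0 i (facePoint_of_mem_zeroBlock hi)⟩, rfl⟩

/-! ### The coordinates of the points -/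

/-- The finite set of the numbers `ζ^c α_j`. -/
def coloredValues (r : ℕ) {k : ℕ} (α : Fin k → ℝ) : Finset ℂ :=
  Finset.univ.image fun p : Fin r × Fin k => zeta r ^ (p.1 : ℕ) * (α p.2 : ℂ)

theorem mem_coloredValues {w : ℂ} :
    w ∈ coloredValues r α ↔ ∃ (c : Fin r) (j : Fin k), w = zeta r ^ (c : ℕ) * (α j : ℂ) := by
  simp [coloredValues, eq_comm]

theorem card_coloredValues [NeZero r] (hα : ∀ j, 0 < α j) (hinj : Function.Injective α) :
    (coloredValues r α).card = k * r := by
  rw [coloredValues, Finset.card_image_of_injective]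
  · simp [mul_comm]
  · rintro ⟨c, j⟩ ⟨d, l⟩ h
    obtain ⟨rfl, rfl⟩ := zeta_pow_mul_inj hα hinj h
    rfl

theorem zero_notMem_coloredValues (hα : ∀ j, 0 < α j) : (0 : ℂ) ∉ coloredValues r α := fun h => by
  obtain ⟨c, j, h⟩ := mem_coloredValues.1 h
  exact zeta_pow_mul_ne_zero r c (hα j) h.symm

/-- This turns the condition on norms defining the point sets into a polynomial one, with `b_j =
α_j^r`. -/
theorem pow_eq_iff_norm_eq [NeZero r] (hα : ∀ j, 0 < α j) {w : ℂ}
    (hw : w ∈ insert 0 (coloredValues r α)) (j : Fin k) :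
    w ^ r = ((α j : ℂ)) ^ r ↔ ‖w‖ = α j := by
  constructor
  · intro h
    have := congrArg norm h
    rw [norm_pow, norm_pow, Complex.norm_of_nonneg (hα j).le] at this
    exact (pow_left_inj₀ (norm_nonneg w) (hα j).le (NeZero.ne r)).1 this
  · intro h
    rcases Finset.mem_insert.1 hw with rfl | hw
    · rw [norm_zero] at h
      exact absurd h (hα j).ne
    · obtain ⟨c, l, rfl⟩ := mem_coloredValues.1 hw
      rw [norm_zeta_pow_mul c (hα l)] at h
      rw [h, mul_pow, ← pow_mul, mul_comm (c : ℕ), pow_mul, (zeta_primitive r).pow_eq_one, one_pow, one_mul]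

theorem card_filter_pow_eq [NeZero r] (hα : ∀ j, 0 < α j) (hinj : Function.Injective α)
    {W : Finset ℂ} (hW : coloredValues r α ⊆ W) (hW' : W ⊆ insert 0 (coloredValues r α))
    (j : Fin k) : (W.filter fun w => w ^ r = ((α j : ℂ)) ^ r).card = r := by
  have : (W.filter fun w => w ^ r = ((α j : ℂ)) ^ r) =
      Finset.univ.image fun c : Fin r => zeta r ^ (c : ℕ) * (α j : ℂ) := by
    ext w
    rw [Finset.mem_filter, Finset.mem_image]
    constructor
    · rintro ⟨hw, h⟩
      rw [pow_eq_iff_norm_eq hα (hW' hw)] at h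
      rcases Finset.mem_insert.1 (hW' hw) with rfl | hw
      · rw [norm_zero] at h
        exact absurd h (hα j).ne
      · obtain ⟨c, l, rfl⟩ := mem_coloredValues.1 hw
        rw [norm_zeta_pow_mul c (hα l)] at h
        exact ⟨c, Finset.mem_univ _, by rw [h]⟩
    · rintro ⟨c, -, rfl⟩
      have hw := hW (mem_coloredValues.2 ⟨c, j, rfl⟩)
      exact ⟨hw, (pow_eq_iff_norm_eq hα (hW' hw) j).2 (norm_zeta_pow_mul c (hα j))⟩
  rw [this, Finset.card_image_of_injective, Finset.card_univ, Fintype.card_fin]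
  exact fun c d h => (zeta_pow_mul_inj hα hinj h).1

theorem range_subset_range_norm_iff [NeZero r] (hα : ∀ j, 0 < α j) {y : Fin n → ℂ}
    (hy : ∀ i, y i ∈ insert 0 (coloredValues r α)) :
    (Set.range α ⊆ Set.range fun i => ‖y i‖) ↔
      ∀ b ∈ Finset.univ.image fun j => (α j : ℂ) ^ r, ∃ i, y i ^ r = b := by
  simp only [Set.range_subset_iff, Set.mem_range, Finset.mem_image, Finset.mem_univ, true_and,
    forall_exists_index, forall_apply_eq_imp_iff, pow_eq_iff_norm_eq hα (hy _)]

theorem pointsY_eq_hitPoints [NeZero r] (hα : ∀ j, 0 < α j) : pointsY r n k α =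
    hitPoints r n (insert 0 (coloredValues r α)) (Finset.univ.image fun j => (α j : ℂ) ^ r) := by
  ext y
  have h : (∀ i, y i = 0 ∨ ∃ (c : Fin r) (j : Fin k), y i = zeta r ^ (c : ℕ) * (α j : ℂ)) ↔
      ∀ i, y i ∈ insert 0 (coloredValues r α) := by
    simp only [Finset.mem_insert, mem_coloredValues]
  rw [Finset.mem_coe, mem_hitPoints, pointsY, Set.mem_ofPred_eq, h]
  exact and_congr_right fun hy => range_subset_range_norm_iff hα hy

theorem pointsZ_eq_hitPoints [NeZero r] (hα : ∀ j, 0 < α j) : pointsZ r n k α =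
    hitPoints r n (coloredValues r α) (Finset.univ.image fun j => (α j : ℂ) ^ r) := by
  ext y
  rw [pointsZ, Set.mem_ofPred_eq, pointsY_eq_hitPoints hα, Finset.mem_coe, Finset.mem_coe,
    mem_hitPoints, mem_hitPoints, and_right_comm, ← forall_and]
  refine and_congr_left fun _ => forall_congr' fun i => ?_
  rw [Finset.mem_insert]
  exact ⟨fun h => h.1.resolve_left h.2,
    fun h => ⟨Or.inr h, fun h0 => zero_notMem_coloredValues hα (h0 ▸ h)⟩⟩

theorem ofReal_pow_injective [NeZero r] (hα : ∀ j, 0 < α j) (hinj : Function.Injective α) :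
    Function.Injective fun j => (α j : ℂ) ^ r := fun j l h => hinj (by
  have := congrArg norm h
  simp only [norm_pow, Complex.norm_of_nonneg (hα _).le] at this
  exact (pow_left_inj₀ (hα j).le (hα l).le (NeZero.ne r)).1 this)

/-- Both point sets are covered at once: `W` is the set of values `ζ^c α_j`, with or without `0`.
The number of points and the bound on the spanning set are the same `hitCount r W.card n k`. -/
theorem finite_and_truncIdeal [NeZero r] (hα : ∀ j, 0 < α j) (hinj : Function.Injective α)
    {W : Finset ℂ} (hW : coloredValues r α ⊆ W) (hW' : W ⊆ insert 0 (coloredValues r α))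
    {X : Type*} {y : X → Fin n → ℂ} (hy : Function.Injective y)
    (hrange : Set.range y = hitPoints r n W (Finset.univ.image fun j => (α j : ℂ) ^ r)) :
    Finite X ∧ truncIdeal r n k W.card ≤ topIdeal (Set.range y) ∧
      SpannedBy (truncIdeal r n k W.card) (Nat.card X) := by
  have hr : 0 < r := Nat.pos_of_neZero r
  have hfib : ∀ b ∈ Finset.univ.image fun j => (α j : ℂ) ^ r,
      (W.filter fun w => w ^ r = b).card = r := fun b hb => by
    obtain ⟨j, -, rfl⟩ := Finset.mem_image.1 hb
    exact card_filter_pow_eq hα hinj hW hW' j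
  have hcardB : (Finset.univ.image fun j => (α j : ℂ) ^ r).card = k := by
    rw [Finset.card_image_of_injective _ (ofReal_pow_injective hα hinj), Finset.card_univ,
      Fintype.card_fin]
  have hmem : ∀ z ∈ Set.range y, (∀ i, z i ∈ W) ∧
      ∀ b ∈ Finset.univ.image fun j => (α j : ℂ) ^ r, ∃ i, z i ^ r = b := fun z hz => by
    rw [hrange, Finset.mem_coe] at hz
    exact mem_hitPoints.1 hz
  have hcard : Nat.card X = hitCount r W.card n k := by
    rw [← Nat.card_range_of_injective hy, hrange, SetLike.coe_sort_coe, Nat.card_eq_fintype_card,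
      Fintype.card_coe, card_hitPoints hfib, hcardB]
  refine ⟨?_, truncIdeal_le_topIdeal hr (ofReal_pow_injective hα hinj)
    (fun z hz => (hmem z hz).1) fun z hz j =>
      (hmem z hz).2 _ (Finset.mem_image_of_mem _ (Finset.mem_univ j)), ?_⟩
  · have : (Set.range y).Finite := hrange ▸ Finset.finite_toSet _
    exact Set.finite_range_iff hy |>.1 this
  · rw [hcard]
    have := card_mul_le_card hfib
    rw [hcardB] at this
    exact spannedBy_truncIdeal hr this

theorem finite_face_and_idealI [NeZero r] (hα : ∀ j, 0 < α j) (hinj : Function.Injective α)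
    (hk : k ≤ n) : Finite (Face r n k) ∧
      idealI r n k ≤ topIdeal (Set.range (facePoint α : Face r n k → Fin n → ℂ)) ∧
      SpannedBy (idealI r n k) (Nat.card (Face r n k)) := by
  have h := finite_and_truncIdeal (r := r) (n := n) hα hinj (Finset.subset_insert 0 _) subset_rfl
    (facePoint_injective hα hinj) ((range_facePoint hα hinj).trans (pointsY_eq_hitPoints hα))
  rwa [Finset.card_insert_of_notMem (zero_notMem_coloredValues hα), card_coloredValues hα hinj,
    ← genIdeal_eq_truncIdeal hk] at h

theorem finite_OP_and_idealJ [NeZero r] (hα : ∀ j, 0 < α j) (hinj : Function.Injective α)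
    (hk : k ≤ n) : Finite (OP r n k) ∧
      idealJ r n k ≤ topIdeal (Set.range fun σ : OP r n k => facePoint α σ.1) ∧
      SpannedBy (idealJ r n k) (Nat.card (OP r n k)) := by
  have h := finite_and_truncIdeal (r := r) (n := n) hα hinj subset_rfl (Finset.subset_insert 0 _)
    ((facePoint_injective hα hinj).comp Subtype.val_injective)
    ((range_facePoint_OP hα hinj).trans (pointsZ_eq_hitPoints hα))
  rwa [card_coloredValues hα hinj, ← genIdeal_eq_truncIdeal hk] at h

end

theorem homogeneousComponent_mem_genIdeal {r n k m : ℕ} (hk : k ≤ n) :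
    ∀ f ∈ genIdeal r n k m, ∀ d, homogeneousComponent d f ∈ genIdeal r n k m := by
  rw [genIdeal_eq_truncIdeal hk]
  exact fun f hf d => homogeneousComponent_mem_truncIdeal hf d

end

end ColoredCoinvariant

/-! ### The module isomorphisms and the equalities of ideals -/

open ColoredCoinvariant

theorem mainTheorem2 (r n k : ℕ) [NeZero r] (hr : 2 ≤ r) (hn : 1 ≤ n) (hk : k ≤ n) :
    Nonempty ((ColoredCoinvariant.repR r n k).Equiv
      (Representation.ofMulAction ℂ (ColoredCoinvariant.Gn r n)
        (ColoredCoinvariant.Face r n k))) ∧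
    Nonempty ((ColoredCoinvariant.repS r n k).Equiv
      (Representation.ofMulAction ℂ (ColoredCoinvariant.Gn r n)
        (ColoredCoinvariant.OP r n k))) ∧
    ∀ α : Fin k → ℝ, (∀ j, 0 < α j) → StrictMono α →
      ColoredCoinvariant.idealI r n k =
        ColoredCoinvariant.topIdeal (ColoredCoinvariant.pointsY r n k α) ∧
      ColoredCoinvariant.idealJ r n k =
        ColoredCoinvariant.topIdeal (ColoredCoinvariant.pointsZ r n k α) := by
  -- The module statements do not involve `α`, so any distinct positive radii serve; the choice is
  -- `1, …, k`.
  have hβ : ∀ j : Fin k, 0 < ((j : ℕ) : ℝ) + 1 := fun j => by positivity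
  have hβ' : Function.Injective fun j : Fin k => ((j : ℕ) : ℝ) + 1 := fun i j h =>
    Fin.ext (by exact_mod_cast add_right_cancel h)
  refine ⟨?_, ?_, fun α hα hmono => ⟨?_, ?_⟩⟩
  · obtain ⟨hfin, hle, hspan⟩ := finite_face_and_idealI (r := r) hβ hβ' hk
    exact nonempty_quotientRep_equiv (facePoint_injective hβ hβ') facePoint_smul
      (homogeneousComponent_mem_genIdeal hk) _ hle hspan
  · obtain ⟨hfin, hle, hspan⟩ := finite_OP_and_idealJ (r := r) hβ hβ' hk
    exact nonempty_quotientRep_equiv (y := fun σ : OP r n k => facePoint _ σ.1)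
      ((facePoint_injective hβ hβ').comp Subtype.val_injective) (fun g σ => facePoint_smul g σ.1) (homogeneousComponent_mem_genIdeal hk) _ hle hspan
  · obtain ⟨hfin, hle, hspan⟩ := finite_face_and_idealI (r := r) hα hmono.injective hk
    rw [← range_facePoint hα hmono.injective]
    exact topIdeal_eq (r := r) (facePoint_injective hα hmono.injective)
      (homogeneousComponent_mem_genIdeal hk) hle hspan
  · obtain ⟨hfin, hle, hspan⟩ := finite_OP_and_idealJ (r := r) hα hmono.injective hk
    rw [← range_facePoint_OP hα hmono.injective]
    exact topIdeal_eq (r := r)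
      ((facePoint_injective hα hmono.injective).comp Subtype.val_injective)
      (homogeneousComponent_mem_genIdeal hk) hle hspan
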